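/- Let $n\ge 2$ be an integer, let $[n]=\{1,\ldots,n\}$, let $\mathsf{Path}_n$ be the path graph with $n$ vertices and let $\Lambda_{\mathsf{Path}_n}$ be the set of its labelings, that is, of bijections $\sigma$ from the vertex set of $\mathsf{Path}_n$ to $\mathbb Z/n\mathbb Z$. For $i\in\mathbb Z/n\mathbb Z$, let $\tau_i\colon\Lambda_{\mathsf{Path}_n}\to\Lambda_{\mathsf{Path}_n}$ be the toggle operator that sends $\sigma$ to $(i\;\,i+1)\circ\sigma$ if the vertices $\sigma^{-1}(i)$ and $\sigma^{-1}(i+1)$ are not adjacent, and to $\sigma$ otherwise. Let $\pi\colon[n]\to\mathbb Z/n\mathbb Z$ be a bijection, and let $\mathrm{TPro}_\pi=\tau_{\pi(n)}\circ\cdots\circ\tau_{\pi(2)}\circ\tau_{\pi(1)}$ be the corresponding permutoric promotion operator. Let $d$ be the number of cyclic descents of $\pi^{-1}$, i.e., of elements $i\in\mathbb Z/n\mathbb Z$ such that $\pi^{-1}(i)>\pi^{-1}(i+1)$ (so $1\le d\le n-1$). Then $\mathrm{TPro}_\pi$ has order $d(n-d)$. Moreover, the triple \[\left(\Lambda_{\mathsf{Path}_n},\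 \mathrm{TPro}_\pi,\ n\,(d-1)!\,(n-d-1)!\,[n-d]_{q^d}{n-1\brack d-1}_q\right)\] exhibits the cyclic sieving phenomenon. Here $[k]_q=1+q+\cdots+q^{k-1}$, $[k]_q!=[k]_q[k-1]_q\cdots[1]_q$ and ${k\brack r}_q=\dfrac{[k]_q!}{[r]_q!\,[k-r]_q!}\in\mathbb C[q]$. If $X$ is a finite set, $f\colon X\to X$ is an invertible map, $\omega$ is its order (the smallest positive integer such that $f^\omega$ is the identity), and $F(q)\in\mathbb C[q]$, the triple $(X,f,F(q))$ exhibits the cyclic sieving phenomenon if, for every integer $k$, the number of elements of $X$ fixed by $f^k$ is $F(e^{2\pi ik/\omega})$. -/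

import Mathlib

open Polynomial

/-- The labelings `Λ_G` of a graph on the vertex set `V` with `n` vertices:
bijections `V → ℤ/nℤ`. -/
abbrev Labeling (V : Type*) (n : ℕ) : Type _ := V ≃ ZMod n

/-- The underlying map of the toggle `τ_i`: it swaps the labels `i` and `i + 1` if they are
assigned to nonadjacent vertices of `G`, and it does nothing otherwise. -/
noncomputable def toggleFun {V : Type*} (G : SimpleGraph V) {n : ℕ} (i : ZMod n)
    (σ : Labeling V n) : Labeling V n :=
  open Classical in
  if G.Adj (σ.symm i) (σ.symm (i + 1)) then σ else σ.trans (Equiv.swap i (i + 1))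

theorem toggleFun_involutive {V : Type*} (G : SimpleGraph V) {n : ℕ} (i : ZMod n) :
    Function.Involutive (toggleFun G i : Labeling V n → Labeling V n) := by
  intro σ
  by_cases h : G.Adj (σ.symm i) (σ.symm (i + 1))
  · simp [toggleFun, h]
  · have h' : ¬ G.Adj (σ.symm (i + 1)) (σ.symm i) := fun hh => h hh.symm
    ext v
    simp [toggleFun, h, h']

/-- The toggle operator `τ_i : Λ_G → Λ_G`, as a permutation of `Λ_G`. -/
noncomputable def toggle {V : Type*} (G : SimpleGraph V) {n : ℕ} (i : ZMod n) :
    Equiv.Perm (Labeling V n) :=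
  (toggleFun_involutive G i).toPerm

/-- The permutoric promotion operator `τ_{π(n)} ⋯ τ_{π(2)} τ_{π(1)}` (so `τ_{π(1)}` is applied
first). The linearly ordered set `[n] = {1, …, n}` is represented by `Fin n`. -/
noncomputable def permutoricPromotion {V : Type*} (G : SimpleGraph V) {n : ℕ}
    (π : Fin n ≃ ZMod n) : Equiv.Perm (Labeling V n) :=
  (List.ofFn fun j : Fin n => toggle G (π j)).reverse.prod

/-- The number of cyclic descents of `π⁻¹`, that is, of elements `i` of `ℤ/nℤ` such that
`π⁻¹(i) > π⁻¹(i + 1)`. -/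
noncomputable def cyclicDescents {n : ℕ} (π : Fin n ≃ ZMod n) : ℕ :=
  {i : ZMod n | π.symm i > π.symm (i + 1)}.ncard

/-- The `q`-integer `[k]_q = 1 + q + ⋯ + q^(k-1)`, as a polynomial in `q = X`. -/
noncomputable def qInt (k : ℕ) : ℂ[X] := ∑ i ∈ Finset.range k, X ^ i

/-- The `q`-factorial `[k]_q! = [k]_q [k-1]_q ⋯ [1]_q`. -/
noncomputable def qFactorial (k : ℕ) : ℂ[X] := ∏ i ∈ Finset.range k, qInt (i + 1)

/-- The `q`-binomial coefficient `[k]_q! / ([r]_q! [k-r]_q!)`, for `r ≤ k`. The division of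
polynomials is exact, see `qBinomial_mul`. -/
noncomputable def qBinomial (k r : ℕ) : ℂ[X] :=
  qFactorial k / (qFactorial r * qFactorial (k - r))

theorem qFactorial_mul_dvd (r s : ℕ) : qFactorial r * qFactorial s ∣ qFactorial (r + s) := by
  have hsucc : ∀ m, qFactorial (m + 1) = qFactorial m * qInt (m + 1) := fun m =>
    Finset.prod_range_succ _ _
  induction r generalizing s with
  | zero => simp [qFactorial]
  | succ r ihr =>
    induction s with
    | zero => simp [qFactorial]
    | succ s ihs =>
      have hsum : qInt (r + 1 + (s + 1)) = qInt (r + 1) + X ^ (r + 1) * qInt (s + 1) := by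
        rw [qInt, Finset.sum_range_add, qInt, qInt, Finset.mul_sum]
        simp only [pow_add]
      have h1 := mul_dvd_mul_right (ihr (s + 1)) (qInt (r + 1))
      have h2 := mul_dvd_mul_right ihs (qInt (s + 1))
      have e : qFactorial (r + 1 + (s + 1)) = qFactorial (r + (s + 1)) * qInt (r + 1)
          + X ^ (r + 1) * (qFactorial (r + 1 + s) * qInt (s + 1)) := by
        rw [← add_assoc (r + 1) s 1, hsucc, add_assoc (r + 1) s 1, hsum,
          show r + (s + 1) = r + 1 + s by omega]
        ring
      rw [e]
      refine dvd_add ?_ (Dvd.dvd.mul_left ?_ _)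
      · rw [hsucc r]
        convert h1 using 1
        ring
      · rw [hsucc s, ← mul_assoc]
        exact h2

theorem qInt_succ_ne_zero (k : ℕ) : qInt (k + 1) ≠ 0 := by
  intro h
  have h1 := congrArg (Polynomial.eval 1) h
  simp only [qInt, eval_finsetSum, eval_pow, eval_X, one_pow, Finset.sum_const,
    Finset.card_range, nsmul_eq_mul, mul_one, eval_zero] at h1
  exact Nat.cast_ne_zero.mpr (Nat.succ_ne_zero k) h1

theorem qFactorial_ne_zero (k : ℕ) : qFactorial k ≠ 0 :=
  Finset.prod_ne_zero_iff.mpr fun i _ => qInt_succ_ne_zero i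

/-- The division in the definition of the `q`-binomial coefficient is exact. -/
theorem qBinomial_mul {k r : ℕ} (h : r ≤ k) :
    qBinomial k r * (qFactorial r * qFactorial (k - r)) = qFactorial k := by
  have hd := qFactorial_mul_dvd r (k - r)
  rw [Nat.add_sub_cancel' h] at hd
  have h0 : qFactorial r * qFactorial (k - r) ≠ 0 :=
    mul_ne_zero (qFactorial_ne_zero _) (qFactorial_ne_zero _)
  rw [mul_comm]
  exact EuclideanDomain.mul_div_cancel' h0 hd

/-- The triple `(X, f, F(q))` exhibits the cyclic sieving phenomenon: with `ω` the order of the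
invertible map `f` of the finite set `X`, for every integer `k` the number of elements of `X`
fixed by `f ^ k` is `F (e^(2πik/ω))`. -/
def CyclicSieving {X : Type*} [Finite X] (f : Equiv.Perm X) (F : ℂ[X]) : Prop :=
  ∀ k : ℤ, (Nat.card (Function.fixedPoints (f ^ k : Equiv.Perm X)) : ℂ) =
    F.eval (Complex.exp (2 * Real.pi * Complex.I * k / orderOf f))

/-- The polynomial `n (d-1)! (n-d-1)! [n-d]_{q^d} [n-1 choose d-1]_q`, for
`1 ≤ d ≤ n - 1` (the number of cyclic descents lies in this range when `2 ≤ n`). -/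
noncomputable def sievingPolynomial (n d : ℕ) : ℂ[X] :=
  ((n * (d - 1).factorial * (n - d - 1).factorial : ℕ) : ℂ[X]) *
    (qInt (n - d)).comp (X ^ d) * qBinomial (n - 1) (d - 1)

/-!
Permutoric promotion on a path is read as a motion of lines on the cycle `ℤ/nℤ`. If no two vertices
were adjacent, then the toggles would let a label that starts to the right (left) travel to the
right (left) forever. So there are `d` right-moving lines and `n - d` left-moving lines, and each
toggle is the meeting of one line of each kind. Labelings by positions become labelings by lines
(`inl a` and `inr b`), and a toggle becomes a `bounce`: two lines that meet exchange their vertices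
exactly if these are adjacent in the path.

Toggles that act after both of their neighbours can be conjugated to the front. Hence the conjugacy
class of promotion depends only on `d` (`isConj_permutoricPromotion`), and one may assume that the
lines start in a standard order. Then promotion is the product of two commuting operators
(`hopChain_mul_hopChain`, `commute_passColumn_passRow`): one right-moving line passes all
left-moving ones, and conversely. The `d`-th power of the first and the `(n - d)`-th power of the
second are both equal to the product `Φ` of all `d (n - d)` bounces (`passColumn_pow`,
`passRow_pow`).

A bounce preserves the order along the path of the vertices on right-moving lines, and the order of
those on left-moving lines. Promotion shifts the lines of each kind cyclically, so its `k`-th power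
has no fixed points unless `d ∣ k` and `n - d ∣ k` (`dvd_of_mem_fixedPoints`), and then it is
`Φ ^ (k / d + k / (n - d))`. With the two orders fixed, a labeling is a binary word, and `Φ` is a
product of toggles of boxes in a `d × (n - d)` rectangle in which only neighbouring boxes fail to
commute. Changing the two orders permutes the columns and the rows of that product, and does not
change its conjugacy class (`isConj_gridProd_perm`, a statement about Coxeter elements). So all
`d! (n - d)!` choices of the orders contribute equally many fixed points, and it suffices to look
at sorted labelings, on which `Φ` is the rotation of binary words
(`isLeft_gridProd_sortedBounce`).

It remains to count the `d`-subsets of `ℤ/nℤ` that are invariant under a translation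
(`ZMod.card_translation_invariant`) and to compare the result with the value of the sieving
polynomial, which the `q`-Lucas theorem provides (`qBinomialEval_lucas`).
-/

/-! ### Products of partially commuting factors -/

/-- Two arrangements of the same factors have the same product if they put every two factors that
do not commute in the same order. -/
theorem prod_map_eq_of_pairwise {α G : Type*} [Monoid G] (f : α → G) (O : α → α → Prop)
    (hO : ∀ x y, O x y → ¬ O y x) {l l' : List α} (hp : l.Perm l')
    (hl : l.Pairwise fun x y => Commute (f x) (f y) ∨ O x y)
    (hl' : l'.Pairwise fun x y => Commute (f x) (f y) ∨ O x y) :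
    (l.map f).prod = (l'.map f).prod := by
  induction l' generalizing l with
  | nil => rw [hp.eq_nil]
  | cons x t ih =>
    obtain ⟨X, Y, rfl⟩ := List.append_of_mem (hp.mem_iff.mpr List.mem_cons_self)
    have hp' : (X ++ Y).Perm t := List.perm_cons x |>.mp (List.perm_middle.symm.trans hp)
    -- `x` comes first in the other list, so it can be moved to the front in this one
    have hx : ∀ y ∈ X, Commute (f x) (f y) := by
      intro y hy
      have h1 := (List.pairwise_append.mp hl).2.2 y hy x List.mem_cons_self
      have hyt : y ∈ t := hp'.mem_iff.mp (List.mem_append_left _ hy)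
      have h2 := (List.pairwise_cons.mp hl').1 y hyt
      rcases h1 with h1 | h1
      · exact h1.symm
      · rcases h2 with h2 | h2
        · exact h2
        · exact absurd h1 (hO _ _ h2)
    have hc : Commute (f x) (X.map f).prod :=
      Commute.list_prod_right _ _ (by simpa using hx)
    have hsub : (X ++ Y).Sublist (X ++ x :: Y) :=
      List.Sublist.append_left (List.sublist_cons_self _ _) _
    have := ih hp' (hl.sublist hsub) (List.pairwise_cons.mp hl').2
    rw [List.map_cons, List.prod_cons, ← this]
    simp only [List.map_append, List.map_cons, List.prod_append, List.prod_cons]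
    rw [← mul_assoc, ← hc.eq, mul_assoc]

/-- All Coxeter elements of a path are conjugate: if only consecutive factors fail to commute,
then the conjugacy class of their product does not depend on their order. The proof moves the last
factor next to its only neighbour by a cyclic rotation, and merges the two into one factor. -/
theorem isConj_prod_map_range {G : Type*} [Group G] (d : ℕ) (c : ℕ → G)
    (hc : ∀ i j, i + 1 < j → j < d → Commute (c i) (c j)) (l : List ℕ)
    (hl : l.Perm (List.range d)) :
    IsConj (l.map c).prod ((List.range d).map c).prod := by
  induction d generalizing c l with
  | zero => rw [hl.eq_nil]; exact IsConj.refl _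
  | succ d ih =>
    rcases d with _ | d
    · rw [List.perm_singleton.mp (show l.Perm [0] from hl)]; rfl
    obtain ⟨X, Y, rfl⟩ := List.append_of_mem
      (hl.mem_iff.mpr (List.mem_range.mpr (Nat.lt_succ_self (d + 1))))
    have hYX : (Y ++ X).Perm (List.range (d + 1)) := by
      have h1 : ((d + 1) :: (X ++ Y)).Perm ((d + 1) :: List.range (d + 1)) := by
        refine List.perm_middle.symm.trans (hl.trans ?_)
        rw [List.range_succ (n := d + 1)]
        exact List.perm_append_comm
      exact List.perm_append_comm.trans ((List.perm_cons _).mp h1)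
    have hrot : IsConj ((X ++ (d + 1) :: Y).map c).prod (((Y ++ X).map c).prod * c (d + 1)) := by
      rw [isConj_iff]
      refine ⟨((X.map c).prod * c (d + 1))⁻¹, ?_⟩
      simp only [List.map_append, List.map_cons, List.prod_append, List.prod_cons]
      group
    refine hrot.trans ?_
    have hnd : (Y ++ X).Nodup := hYX.nodup_iff.mpr List.nodup_range
    obtain ⟨U, V, hUV⟩ := List.append_of_mem
      (hYX.mem_iff.mpr (List.mem_range.mpr (Nat.lt_succ_self d)))
    rw [hUV] at hYX hnd ⊢
    -- the factors `c d` and `c (d + 1)` merged into one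
    let c' : ℕ → G := fun j => if j = d then c d * c (d + 1) else c j
    have hmem : ∀ x ∈ U ++ V, x ≠ d ∧ x < d + 1 := by
      intro x hx
      refine ⟨?_, List.mem_range.mp (hYX.mem_iff.mp ?_)⟩
      · rintro rfl
        exact (List.nodup_cons.mp (List.nodup_middle.mp hnd)).1 hx
      · exact List.perm_middle.mem_iff.mpr (List.mem_cons_of_mem _ hx)
    have hmap : ∀ W : List ℕ, (∀ x ∈ W, x ≠ d) → W.map c' = W.map c := by
      intro W hW
      exact List.map_congr_left fun x hx => if_neg (hW x hx)
    have hV : Commute (c (d + 1)) (V.map c).prod := by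
      refine Commute.list_prod_right _ _ ?_
      intro y hy
      obtain ⟨x, hx, rfl⟩ := List.mem_map.mp hy
      have := hmem x (List.mem_append_right _ hx)
      exact (hc x (d + 1) (by omega) (by omega)).symm
    have e1 : ((U ++ d :: V).map c).prod * c (d + 1) = ((U ++ d :: V).map c').prod := by
      simp only [List.map_append, List.map_cons, List.prod_append, List.prod_cons]
      rw [hmap U fun x hx => (hmem x (List.mem_append_left _ hx)).1,
        hmap V fun x hx => (hmem x (List.mem_append_right _ hx)).1]
      simp only [c', if_true, mul_assoc]
      rw [hV.eq]
    have e2 : ((List.range (d + 1 + 1)).map c).prod = ((List.range (d + 1)).map c').prod := by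
      rw [List.range_succ, List.range_succ]
      simp only [List.map_append, List.prod_append, List.map_cons, List.map_nil,
        List.prod_singleton]
      rw [hmap (List.range d) fun x hx => (List.mem_range.mp hx).ne]
      simp [c', mul_assoc]
    rw [e1, e2]
    refine ih c' ?_ _ hYX
    intro i j hij hj
    have hi : c' i = c i := if_neg (by omega)
    rw [hi]
    by_cases h : j = d
    · subst h
      simp only [c', if_true]
      exact (hc i j hij (by omega)).mul_right (hc i (j + 1) (by omega) (by omega))
    · simp only [c', h, if_false]
      exact hc i j hij (by omega)

theorem isConj_prod_map_finRange {G : Type*} [Group G] {d : ℕ} (c : Fin d → G)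
    (hc : ∀ i j : Fin d, i.val + 1 < j.val → Commute (c i) (c j)) (g : Equiv.Perm (Fin d)) :
    IsConj ((List.finRange d).map fun a => c (g a)).prod ((List.finRange d).map c).prod := by
  let c' : ℕ → G := fun k => if h : k < d then c ⟨k, h⟩ else 1
  have hc' : ∀ x : Fin d, c' x.val = c x := fun x => by simp [c']
  have key := isConj_prod_map_range d c' (by
    intro i j hij hj
    rw [hc' ⟨j, hj⟩, hc' ⟨i, by omega⟩]
    exact hc _ _ hij) ((List.finRange d).map fun a => (g a).val) (by
    have h1 : ((List.finRange d).map g).Perm (List.finRange d) :=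
      (List.perm_ext_iff_of_nodup ((List.nodup_finRange d).map g.injective)
        (List.nodup_finRange d)).mpr fun a => by
          simp only [List.mem_map, List.mem_finRange, true_and, iff_true]
          exact g.surjective a
    have h2 := h1.map Fin.val
    rw [List.map_map, List.map_coe_finRange_eq_range] at h2
    exact h2)
  rw [← List.map_coe_finRange_eq_range, List.map_map, List.map_map] at key
  have e1 : (c' ∘ fun a => (g a).val) = fun a => c (g a) := funext fun a => hc' (g a)
  have e2 : c' ∘ Fin.val = c := funext hc'
  rwa [e1, e2] at key

theorem prod_map_mul_of_commute {α G : Type*} [Monoid G] (f g : α → G) (l : List α)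
    (hl : l.Pairwise fun x y => Commute (g x) (f y)) :
    (l.map fun x => f x * g x).prod = (l.map f).prod * (l.map g).prod := by
  induction l with
  | nil => simp
  | cons x t ih =>
    have hx := (List.pairwise_cons.mp hl).1
    have : Commute (g x) (t.map f).prod := Commute.list_prod_right _ _ (by simpa using hx)
    simp only [List.map_cons, List.prod_cons, ih (List.pairwise_cons.mp hl).2]
    simp only [mul_assoc]
    rw [← mul_assoc (g x), this.eq, mul_assoc]

/-- The product over a grid is the same by columns and by rows if factors that share neither a
column nor a row commute. -/
theorem prod_map_prod_map_comm {α β G : Type*} [Monoid G] (B : α → β → G)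
    (hB : ∀ a a' b b', a ≠ a' → b ≠ b' → Commute (B a b) (B a' b')) (l : List α) (l' : List β)
    (hl : l.Nodup) (hl' : l'.Nodup) :
    (l.map fun a => (l'.map fun b => B a b).prod).prod =
      (l'.map fun b => (l.map fun a => B a b).prod).prod := by
  induction l' with
  | nil => simp
  | cons b t ih =>
    have hb := List.nodup_cons.mp hl'
    simp only [List.map_cons, List.prod_cons]
    rw [← ih hb.2]
    refine prod_map_mul_of_commute _ _ l (hl.imp fun {x y} hxy => ?_)
    refine Commute.list_prod_left _ _ ?_
    intro z hz
    obtain ⟨b', hb', rfl⟩ := List.mem_map.mp hz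
    exact hB _ _ _ _ hxy fun h => hb.1 (h ▸ hb')

theorem semiconjBy_prod_map {α G : Type*} [Monoid G] {s : G} {f g : α → G} (l : List α)
    (h : ∀ x ∈ l, SemiconjBy s (f x) (g x)) : SemiconjBy s (l.map f).prod (l.map g).prod := by
  induction l with
  | nil => simp
  | cons x l ih =>
    rw [List.map_cons, List.map_cons, List.prod_cons, List.prod_cons]
    exact (h x List.mem_cons_self).mul_right (ih fun y hy => h y (List.mem_cons_of_mem _ hy))

/-! ### Toggles as bounces -/

/-- Post-composition of a labeling with a permutation of the labels. -/
def relabel (V : Type*) {X : Type*} : Equiv.Perm X →* Equiv.Perm (V ≃ X) where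
  toFun g := ⟨fun σ => σ.trans g, fun σ => σ.trans g.symm,
    fun σ => by ext; simp, fun σ => by ext; simp⟩
  map_one' := by ext; rfl
  map_mul' g h := by ext; rfl

@[simp] theorem relabel_apply {V X : Type*} (g : Equiv.Perm X) (σ : V ≃ X) :
    relabel V g σ = σ.trans g := rfl

section Bounce

variable {V X : Type*} [DecidableEq X] (G : SimpleGraph V)

/-- The underlying map of `bounce`. -/
noncomputable def bounceFun (x y : X) (σ : V ≃ X) : V ≃ X :=
  open Classical in
  if G.Adj (σ.symm x) (σ.symm y) then σ.trans (Equiv.swap x y) else σ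

theorem bounceFun_involutive (x y : X) : Function.Involutive (bounceFun G x y) := by
  intro σ
  by_cases h : G.Adj (σ.symm x) (σ.symm y)
  · ext v
    simp [bounceFun, h, h.symm]
  · simp [bounceFun, h]

/-- The bounce of the labels `x` and `y`: they are exchanged exactly if they are assigned to
adjacent vertices. -/
noncomputable def bounce (x y : X) : Equiv.Perm (V ≃ X) := (bounceFun_involutive G x y).toPerm

theorem bounce_apply_of_adj {x y : X} {σ : V ≃ X} (h : G.Adj (σ.symm x) (σ.symm y)) :
    bounce G x y σ = σ.trans (Equiv.swap x y) := by
  simp [bounce, bounceFun, h]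

theorem bounce_apply_of_not_adj {x y : X} {σ : V ≃ X} (h : ¬ G.Adj (σ.symm x) (σ.symm y)) :
    bounce G x y σ = σ := by
  simp [bounce, bounceFun, h]

theorem bounce_comm (x y : X) : bounce G x y = bounce G y x := by
  ext1 σ
  by_cases h : G.Adj (σ.symm x) (σ.symm y)
  · rw [bounce_apply_of_adj G h, bounce_apply_of_adj G h.symm, Equiv.swap_comm]
  · rw [bounce_apply_of_not_adj G h, bounce_apply_of_not_adj G fun h' => h h'.symm]

theorem relabel_mul_bounce (g : Equiv.Perm X) (x y : X) :
    relabel V g * bounce G x y = bounce G (g x) (g y) * relabel V g := by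
  ext1 σ
  have e : ∀ z, (σ.trans g).symm (g z) = σ.symm z := fun z => by simp
  by_cases h : G.Adj (σ.symm x) (σ.symm y)
  · have h' : G.Adj ((σ.trans g).symm (g x)) ((σ.trans g).symm (g y)) := by rwa [e, e]
    rw [Equiv.Perm.mul_apply, Equiv.Perm.mul_apply, relabel_apply, relabel_apply,
      bounce_apply_of_adj G h, bounce_apply_of_adj G h']
    ext v
    simp only [Equiv.trans_apply]
    exact g.injective.map_swap _ _ _
  · have h' : ¬ G.Adj ((σ.trans g).symm (g x)) ((σ.trans g).symm (g y)) := by rwa [e, e]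
    rw [Equiv.Perm.mul_apply, Equiv.Perm.mul_apply, relabel_apply, relabel_apply,
      bounce_apply_of_not_adj G h, bounce_apply_of_not_adj G h']

theorem bounce_symm_apply_of_ne {x y z : X} (hx : z ≠ x) (hy : z ≠ y) (σ : V ≃ X) :
    (bounce G x y σ).symm z = σ.symm z := by
  by_cases h : G.Adj (σ.symm x) (σ.symm y)
  · rw [bounce_apply_of_adj G h]
    simp [Equiv.swap_apply_of_ne_of_ne hx hy]
  · rw [bounce_apply_of_not_adj G h]

theorem commute_bounce {x y z w : X} (hzx : z ≠ x) (hzy : z ≠ y) (hwx : w ≠ x) (hwy : w ≠ y) :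
    Commute (bounce G x y) (bounce G z w) := by
  ext1 σ
  rw [Equiv.Perm.mul_apply, Equiv.Perm.mul_apply]
  have a1 := bounce_symm_apply_of_ne G hzx hzy σ
  have a2 := bounce_symm_apply_of_ne G hwx hwy σ
  have b1 := bounce_symm_apply_of_ne G hzx.symm hwx.symm σ
  have b2 := bounce_symm_apply_of_ne G hzy.symm hwy.symm σ
  by_cases h : G.Adj (σ.symm x) (σ.symm y) <;> by_cases h' : G.Adj (σ.symm z) (σ.symm w)
  · rw [bounce_apply_of_adj G (x := x) (by rwa [b1, b2]), bounce_apply_of_adj G h',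
      bounce_apply_of_adj G (x := z) (by rwa [a1, a2]), bounce_apply_of_adj G h]
    have : Commute (Equiv.swap x y) (Equiv.swap z w) := by
      apply Equiv.Perm.Disjoint.commute
      intro v
      by_cases hv : v = x ∨ v = y
      · right
        rcases hv with rfl | rfl
        · exact Equiv.swap_apply_of_ne_of_ne hzx.symm hwx.symm
        · exact Equiv.swap_apply_of_ne_of_ne hzy.symm hwy.symm
      · left
        push Not at hv
        exact Equiv.swap_apply_of_ne_of_ne hv.1 hv.2
    ext v
    exact congrArg (fun p : Equiv.Perm X => p (σ v)) this.eq
  · rw [bounce_apply_of_not_adj G h',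
      bounce_apply_of_not_adj G (σ := bounce G x y σ) (by rwa [a1, a2])]
  · rw [bounce_apply_of_not_adj G h,
      bounce_apply_of_not_adj G (σ := bounce G z w σ) (by rwa [b1, b2])]
  · rw [bounce_apply_of_not_adj G h, bounce_apply_of_not_adj G h', bounce_apply_of_not_adj G h]

/-- The toggle of two labels `x` and `y`: they are exchanged unless they are assigned to
adjacent vertices. -/
noncomputable def hop (x y : X) : Equiv.Perm (V ≃ X) :=
  relabel V (Equiv.swap x y) * bounce G x y

theorem hop_apply_of_adj {x y : X} {σ : V ≃ X} (h : G.Adj (σ.symm x) (σ.symm y)) :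
    hop G x y σ = σ := by
  rw [hop, Equiv.Perm.mul_apply, bounce_apply_of_adj G h]
  ext v
  simp

theorem hop_apply_of_not_adj {x y : X} {σ : V ≃ X} (h : ¬ G.Adj (σ.symm x) (σ.symm y)) :
    hop G x y σ = σ.trans (Equiv.swap x y) := by
  rw [hop, Equiv.Perm.mul_apply, bounce_apply_of_not_adj G h, relabel_apply]

theorem hop_comm (x y : X) : hop G x y = hop G y x := by
  rw [hop, hop, bounce_comm, Equiv.swap_comm]

theorem commute_hop {x y z w : X} (hzx : z ≠ x) (hzy : z ≠ y) (hwx : w ≠ x) (hwy : w ≠ y) :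
    Commute (hop G x y) (hop G z w) := by
  have h1 := commute_bounce G hzx hzy hwx hwy
  have h2 : Commute (relabel V (Equiv.swap x y)) (bounce G z w) := by
    have := relabel_mul_bounce G (Equiv.swap x y) z w
    rwa [Equiv.swap_apply_of_ne_of_ne hzx hzy, Equiv.swap_apply_of_ne_of_ne hwx hwy] at this
  have h3 : Commute (relabel V (Equiv.swap z w)) (bounce G x y) := by
    have := relabel_mul_bounce G (Equiv.swap z w) x y
    rwa [Equiv.swap_apply_of_ne_of_ne hzx.symm hwx.symm,
      Equiv.swap_apply_of_ne_of_ne hzy.symm hwy.symm] at this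
  have h4 : Commute (relabel V (Equiv.swap x y)) (relabel V (Equiv.swap z w)) := by
    refine Commute.map (Equiv.Perm.Disjoint.commute fun v => ?_) _
    by_cases hv : v = x ∨ v = y
    · right
      rcases hv with rfl | rfl
      · exact Equiv.swap_apply_of_ne_of_ne hzx.symm hwx.symm
      · exact Equiv.swap_apply_of_ne_of_ne hzy.symm hwy.symm
    · left
      push Not at hv
      exact Equiv.swap_apply_of_ne_of_ne hv.1 hv.2
  exact (h4.mul_right h2).mul_left (h3.symm.mul_right h1)

theorem toggle_eq_hop {n : ℕ} (i : ZMod n) : toggle G i = hop G i (i + 1) := by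
  ext1 σ
  by_cases h : G.Adj (σ.symm i) (σ.symm (i + 1))
  · rw [hop_apply_of_adj G h]
    simp [toggle, toggleFun, h]
  · rw [hop_apply_of_not_adj G h]
    simp [toggle, toggleFun, h]

theorem permCongr_hop {Y : Type*} [DecidableEq Y] (e : X ≃ Y) (x y : X) :
    ((Equiv.refl V).equivCongr e).permCongr (hop G x y) = hop G (e x) (e y) := by
  ext1 σ
  rw [Equiv.permCongr_apply]
  set τ := ((Equiv.refl V).equivCongr e).symm σ with hτ
  have hs : ∀ z, τ.symm z = σ.symm (e z) := fun z => rfl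
  by_cases h : G.Adj (τ.symm x) (τ.symm y)
  · rw [hop_apply_of_adj G h, hτ, Equiv.apply_symm_apply, hop_apply_of_adj]
    exact h
  · rw [hop_apply_of_not_adj G h, hop_apply_of_not_adj]
    · ext v
      have : τ v = e.symm (σ v) := rfl
      simp [Equiv.equivCongr, this, e.injective.map_swap]
    · exact h

/-- The product of the hops of consecutive entries of a list. -/
noncomputable def hopChain : List X → Equiv.Perm (V ≃ X)
  | [] => 1
  | [_] => 1
  | x :: y :: l => hop G x y * hopChain (y :: l)

theorem permCongr_hopChain {Y : Type*} [DecidableEq Y] (e : X ≃ Y) (l : List X) :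
    ((Equiv.refl V).equivCongr e).permCongr (hopChain G l) = hopChain G (l.map e) := by
  have hmul : ∀ p q : Equiv.Perm (V ≃ X), ((Equiv.refl V).equivCongr e).permCongr (p * q) =
      ((Equiv.refl V).equivCongr e).permCongr p * ((Equiv.refl V).equivCongr e).permCongr q :=
    fun p q => map_mul ((Equiv.refl V).equivCongr e).permCongrHom p q
  have hone : ((Equiv.refl V).equivCongr e).permCongr (1 : Equiv.Perm (V ≃ X)) = 1 :=
    map_one ((Equiv.refl V).equivCongr e).permCongrHom
  induction l with
  | nil => exact hone
  | cons x l ih =>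
    cases l with
    | nil => exact hone
    | cons y l =>
      rw [hopChain, hmul, ih, permCongr_hop]
      rfl

/-- In a chain of hops, the last label `y` of the list travels past all others. Hence the chain is a
product of bounces with `y`, followed by the permutation of the positions that the chain would
induce without obstructions. -/
theorem hopChain_append_singleton (l : List X) (y : X) (hl : (l ++ [y]).Nodup) :
    hopChain G (l ++ [y]) =
      relabel V (l ++ [y]).formPerm * (l.map fun x => bounce G x y).prod := by
  induction l with
  | nil => simp [hopChain]
  | cons x l ih =>
    obtain ⟨hx, hl'⟩ := List.nodup_cons.mp hl
    specialize ih hl'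
    obtain ⟨z, r, hr⟩ : ∃ z r, l ++ [y] = z :: r := by
      cases l with
      | nil => exact ⟨y, [], rfl⟩
      | cons a l => exact ⟨a, l ++ [y], rfl⟩
    have h1 : (l ++ [y]).formPerm y = z := by
      have := List.formPerm_apply_getLast z r
      rw [← this]
      congr 1
      · rw [hr]
      · simp only [← hr, List.getLast_append_singleton]
    have h2 : (l ++ [y]).formPerm x = x := List.formPerm_apply_of_notMem hx
    rw [List.cons_append, List.map_cons, List.prod_cons]
    have h3 : hopChain G (x :: (l ++ [y])) = hop G x z * hopChain G (l ++ [y]) := by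
      rw [hr, hopChain]
    have h4 : (x :: (l ++ [y])).formPerm = Equiv.swap x z * (l ++ [y]).formPerm := by
      rw [hr, List.formPerm_cons_cons]
    have h5 := relabel_mul_bounce G (l ++ [y]).formPerm x y
    rw [h1, h2] at h5
    rw [h3, h4, ih, hop, map_mul, mul_assoc, ← mul_assoc (bounce G x z), ← h5]
    simp only [mul_assoc]

end Bounce

/-! ### Permutoric promotion up to conjugacy -/

theorem commute_toggle {V : Type*} (G : SimpleGraph V) {n : ℕ} {i j : ZMod n} (h : j ≠ i + 1)
    (h' : j ≠ i - 1) : Commute (toggle G i) (toggle G j) := by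
  by_cases hij : i = j
  · rw [hij]
  rw [toggle_eq_hop, toggle_eq_hop]
  refine commute_hop G (Ne.symm hij) h (fun h1 => h' ?_) (fun h1 => hij ?_)
  · rw [← h1]; ring
  · exact (add_right_cancel h1).symm

theorem toggle_pathGraph_two (i : ZMod 2) : toggle (SimpleGraph.pathGraph 2) i = 1 := by
  ext1 σ
  have hne : σ.symm i ≠ σ.symm (i + 1) := by
    intro h
    have key : ∀ i : ZMod 2, i ≠ i + 1 := by decide
    exact key i (σ.symm.injective h)
  have : (SimpleGraph.pathGraph 2).Adj (σ.symm i) (σ.symm (i + 1)) := by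
    rw [SimpleGraph.pathGraph_adj]
    omega
  rw [toggle_eq_hop, hop_apply_of_adj _ this]
  rfl

/-- The list `l` of factors, to be read as a product of toggles, arranges every two neighbours
`i - 1`, `i` of the cycle `ℤ/nℤ` in the order that `A` prescribes: if `i - 1` stands before `i`,
then `i ∈ A`, and otherwise `i ∉ A`. Since the rightmost factor of a product acts first, `i ∈ A`
means that `τ_i` acts before `τ_(i-1)`, so that an unimpeded label leaving position `i` moves to
the right. -/
def IsArranged {n : ℕ} (A : Finset (ZMod n)) (l : List (ZMod n)) : Prop :=
  l.Pairwise fun x y => (y = x - 1 → x ∉ A) ∧ (y = x + 1 → y ∈ A)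

/-- The product of the toggles depends only on the acyclic orientation of the cycle. -/
theorem IsArranged.prod_toggle_eq {n : ℕ} (hn : 2 ≤ n) {A : Finset (ZMod n)}
    {l l' : List (ZMod n)} (hl : IsArranged A l) (hl' : IsArranged A l') (hp : l.Perm l') :
    (l.map (toggle (SimpleGraph.pathGraph n))).prod =
      (l'.map (toggle (SimpleGraph.pathGraph n))).prod := by
  rcases hn.eq_or_lt with rfl | hn
  · simp [funext toggle_pathGraph_two]
  have h2 : (2 : ZMod n) ≠ 0 := by
    intro h
    have h2 : ((2 : ℕ) : ZMod n) = 0 := by exact_mod_cast h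
    rw [ZMod.natCast_eq_zero_iff] at h2
    exact absurd (Nat.le_of_dvd (by norm_num) h2) (by omega)
  refine prod_map_eq_of_pairwise _ (fun x y => (y = x - 1 ∧ x ∉ A) ∨ (y = x + 1 ∧ y ∈ A)) ?_ hp
    (hl.imp ?_) (hl'.imp ?_)
  · rintro x y (⟨rfl, hx⟩ | ⟨rfl, hx⟩) (⟨h, hy⟩ | ⟨h, hy⟩)
    · exact h2 (by linear_combination h)
    · exact hx hy
    · exact hy hx
    · exact h2 (by linear_combination -h)
  all_goals
    intro x y hxy
    by_cases h1 : y = x - 1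
    · exact Or.inr (Or.inl ⟨h1, hxy.1 h1⟩)
    by_cases h3 : y = x + 1
    · exact Or.inr (Or.inr ⟨h3, hxy.2 h3⟩)
    · exact Or.inl (commute_toggle _ h3 h1)

/-- If `τ_i` acts after both of its neighbours, then it can be conjugated to act before them; this
replaces the element `i + 1` of `A` by `i`. -/
theorem IsArranged.flip {n : ℕ} (hn : 2 ≤ n) {A : Finset (ZMod n)} {l : List (ZMod n)}
    (hl : IsArranged A l) (hp : l.Nodup) (hu : ∀ x, x ∈ l) {i : ZMod n} (hi : i ∉ A)
    (hi' : i + 1 ∈ A) (G : SimpleGraph (Fin n)) :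
    ∃ l' : List (ZMod n), l'.Nodup ∧ (∀ x, x ∈ l') ∧ IsArranged (insert i (A.erase (i + 1))) l' ∧
      IsConj (l.map (toggle G)).prod (l'.map (toggle G)).prod := by
  have : Fact (1 < n) := ⟨by omega⟩
  obtain ⟨X, Y, rfl⟩ := List.append_of_mem (hu i)
  have hperm : (X ++ i :: Y).Perm (X ++ Y ++ [i]) :=
    List.perm_middle.trans (List.perm_append_comm (l₁ := [i]))
  obtain ⟨hiXY, -⟩ := List.nodup_cons.mp (List.nodup_middle.mp hp)
  refine ⟨X ++ Y ++ [i], hperm.nodup_iff.mp hp, fun x => hperm.mem_iff.mp (hu x), ?_, ?_⟩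
  · have hXY : IsArranged A (X ++ Y) :=
      hl.sublist (List.Sublist.append_left (List.sublist_cons_self _ _) _)
    refine List.pairwise_append.mpr ⟨?_, List.pairwise_singleton _ _, ?_⟩
    · refine List.Pairwise.imp_of_mem ?_ hXY
      intro x y hx hy hxy
      refine ⟨fun h => ?_, fun h => ?_⟩
      · have hxi : x ≠ i := fun h' => hiXY (h' ▸ hx)
        simp only [Finset.mem_insert, Finset.mem_erase, not_or, not_and]
        exact ⟨hxi, fun _ => hxy.1 h⟩
      · refine Finset.mem_insert_of_mem (Finset.mem_erase.mpr ⟨?_, hxy.2 h⟩)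
        rintro rfl
        exact hiXY (by rwa [add_right_cancel h])
    · intro x hx y hy
      rw [List.mem_singleton] at hy
      subst hy
      refine ⟨fun h => ?_, fun _ => Finset.mem_insert_self _ _⟩
      have : x = y + 1 := by rw [h]; ring
      rw [this]
      simp
  · have hc : Commute (toggle G i) (X.map (toggle G)).prod := by
      refine Commute.list_prod_right _ _ ?_
      intro y hy
      obtain ⟨x, hx, rfl⟩ := List.mem_map.mp hy
      have h := (List.pairwise_append.mp hl).2.2 x hx i List.mem_cons_self
      refine (commute_toggle G (fun h' => hi (h.2 h')) fun h' => h.1 h' ?_).symm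
      rwa [show x = i + 1 by rw [h']; ring]
    rw [isConj_iff]
    refine ⟨(toggle G i)⁻¹, ?_⟩
    simp only [List.map_append, List.map_cons, List.prod_append, List.prod_cons, List.map_nil,
      List.prod_nil]
    rw [← mul_assoc (X.map (toggle G)).prod, ← hc.eq]
    group

theorem ZMod.val_add_one_eq {n : ℕ} [Fact (1 < n)] (x : ZMod n) :
    (x + 1).val = if x.val + 1 = n then 0 else x.val + 1 := by
  have h1 := ZMod.val_lt x
  rw [ZMod.val_add, ZMod.val_one]
  split_ifs with h
  · rw [h, Nat.mod_self]
  · exact Nat.mod_eq_of_lt (by omega)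

theorem Finset.eq_range_card_of_pred_mem (B : Finset ℕ) (hB : ∀ x, x + 1 ∈ B → x ∈ B) :
    B = Finset.range B.card := by
  have h : ∀ x ∈ B, Finset.range (x + 1) ⊆ B := by
    intro x
    induction x with
    | zero => intro hx; simpa using hx
    | succ x ih =>
      intro hx
      rw [Finset.range_add_one]
      exact Finset.insert_subset hx (ih (hB x hx))
  refine Finset.eq_of_subset_of_card_le (fun x hx => ?_) (by simp)
  have := Finset.card_le_card (h x hx)
  rw [Finset.card_range] at this
  exact Finset.mem_range.mpr this

/-- Repeated conjugation moves `A` down to an initial segment; the sum of its elements decreases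
in each step. -/
theorem IsArranged.exists_isConj_initial {n : ℕ} (hn : 2 ≤ n) (G : SimpleGraph (Fin n)) (d : ℕ) :
    ∀ (s : ℕ) (A : Finset (ZMod n)) (l : List (ZMod n)), ∑ x ∈ A, x.val = s → A.card = d →
      IsArranged A l → l.Nodup → (∀ x, x ∈ l) →
      ∃ (A' : Finset (ZMod n)) (l' : List (ZMod n)), (∀ x, x ∈ A' ↔ x.val < d) ∧
        IsArranged A' l' ∧ l'.Nodup ∧ (∀ x, x ∈ l') ∧
        IsConj (l.map (toggle G)).prod (l'.map (toggle G)).prod := by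
  have : Fact (1 < n) := ⟨by omega⟩
  have : NeZero n := ⟨by omega⟩
  intro s
  induction s using Nat.strong_induction_on with
  | _ s ih =>
    intro A l hs hd hl hnd hu
    by_cases hA : ∃ i, i ∉ A ∧ i + 1 ∈ A ∧ i + 1 ≠ 0
    · obtain ⟨i, hi, hi', hi0⟩ := hA
      obtain ⟨l', hnd', hu', hl', hconj⟩ := hl.flip hn hnd hu hi hi' G
      have hi1 : i ∉ A.erase (i + 1) := fun h => hi (Finset.mem_of_mem_erase h)
      have hval : (i + 1).val = i.val + 1 := by
        have h1 := ZMod.val_add_one_eq i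
        split_ifs at h1 with h
        · exact absurd ((ZMod.val_eq_zero _).mp h1) hi0
        · exact h1
      have hsum : ∑ x ∈ insert i (A.erase (i + 1)), x.val < s := by
        rw [Finset.sum_insert hi1, ← hs, ← Finset.add_sum_erase _ _ hi', hval]
        omega
      have hcard : (insert i (A.erase (i + 1))).card = d := by
        rw [Finset.card_insert_of_notMem hi1, Finset.card_erase_of_mem hi', ← hd]
        have := Finset.card_pos.mpr ⟨_, hi'⟩
        omega
      obtain ⟨A'', l'', h1, h2, h3, h4, h5⟩ := ih _ hsum _ l' rfl hcard hl' hnd' hu'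
      exact ⟨A'', l'', h1, h2, h3, h4, hconj.trans h5⟩
    · -- no element of `A` can move down, so `A` is closed downwards
      push Not at hA
      refine ⟨A, l, ?_, hl, hnd, hu, IsConj.refl _⟩
      have hB := Finset.eq_range_card_of_pred_mem (A.image ZMod.val) (by
        intro x hx
        obtain ⟨y, hy, hyx⟩ := Finset.mem_image.mp hx
        have hy0 : y ≠ 0 := by
          rintro rfl
          simp at hyx
        have h1 : y - 1 ∈ A := by
          by_contra h
          exact hy0 (by simpa using hA (y - 1) h (by simpa using hy))
        refine Finset.mem_image.mpr ⟨y - 1, h1, ?_⟩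
        have h2 := ZMod.val_add_one_eq (y - 1)
        rw [sub_add_cancel, hyx] at h2
        split_ifs at h2
        omega)
      rw [Finset.card_image_of_injective _ (ZMod.val_injective n), hd] at hB
      intro x
      rw [← Finset.mem_range, ← hB]
      constructor
      · exact fun h => Finset.mem_image_of_mem _ h
      · intro h
        obtain ⟨y, hy, hyx⟩ := Finset.mem_image.mp h
        rwa [← ZMod.val_injective n hyx]

theorem isArranged_ofFn_reverse {n : ℕ} (π : Fin n ≃ ZMod n) (A : Finset (ZMod n))
    (hA : ∀ i, i ∈ A ↔ π.symm i < π.symm (i - 1)) : IsArranged A (List.ofFn π).reverse := by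
  unfold IsArranged
  rw [List.pairwise_reverse, List.pairwise_ofFn]
  intro i j hij
  refine ⟨fun h => ?_, fun h => ?_⟩
  · rw [hA, ← h]
    simpa using hij.le
  · rw [hA, show π i - 1 = π j by rw [h]; ring]
    simpa using hij

theorem isArranged_initial {n d : ℕ} (hn : 2 ≤ n) (hd : 0 < d) (hdn : d < n)
    (A : Finset (ZMod n)) (hA : ∀ x, x ∈ A ↔ x.val < d) :
    IsArranged A (((List.range (n - d)).map fun j : ℕ => ((n - 1 - j : ℕ) : ZMod n)) ++
      (List.range d).map fun j : ℕ => (j : ZMod n)) := by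
  have : Fact (1 < n) := ⟨by omega⟩
  have hv : ∀ j, j < n → ((j : ℕ) : ZMod n).val = j := fun j hj => ZMod.val_natCast_of_lt hj
  have key : ∀ x y : ZMod n, (d ≤ x.val ∧ y.val < x.val ∧ d ≤ y.val) ∨
      (x.val < y.val ∧ y.val < d) ∨ (d ≤ x.val ∧ y.val < d) →
      (y = x - 1 → x ∉ A) ∧ (y = x + 1 → y ∈ A) := by
    intro x y h
    rw [hA, hA]
    have hx := ZMod.val_lt x
    have hy := ZMod.val_lt y
    refine ⟨fun h1 => ?_, fun h1 => ?_⟩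
    · have h2 := ZMod.val_add_one_eq y
      rw [h1, sub_add_cancel, ← h1] at h2
      split_ifs at h2 <;> omega
    · have h2 := ZMod.val_add_one_eq x
      rw [← h1] at h2
      split_ifs at h2 <;> omega
  refine List.pairwise_append.mpr ⟨?_, ?_, ?_⟩
  · rw [List.pairwise_map]
    refine List.Pairwise.imp_of_mem ?_ (List.pairwise_lt_range (n := n - d))
    intro a b ha hb hab
    rw [List.mem_range] at ha hb
    apply key
    rw [hv _ (by omega), hv _ (by omega)]
    omega
  · rw [List.pairwise_map]
    refine List.Pairwise.imp_of_mem ?_ (List.pairwise_lt_range (n := d))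
    intro a b ha hb hab
    rw [List.mem_range] at ha hb
    apply key
    rw [hv _ (by omega), hv _ (by omega)]
    omega
  · intro x hx y hy
    obtain ⟨a, ha, rfl⟩ := List.mem_map.mp hx
    obtain ⟨b, hb, rfl⟩ := List.mem_map.mp hy
    rw [List.mem_range] at ha hb
    apply key
    rw [hv _ (by omega), hv _ (by omega)]
    omega

/-- Up to conjugacy, permutoric promotion depends only on the number of cyclic descents. -/
theorem isConj_permutoricPromotion {n d : ℕ} (hn : 2 ≤ n) (π : Fin n ≃ ZMod n)
    (hd : d = cyclicDescents π) :
    (0 < d ∧ d < n) ∧ IsConj (permutoricPromotion (SimpleGraph.pathGraph n) π)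
      ((((List.range (n - d)).map fun j : ℕ => ((n - 1 - j : ℕ) : ZMod n)) ++
        (List.range d).map fun j : ℕ => (j : ZMod n)).map
          (toggle (SimpleGraph.pathGraph n))).prod := by
  have : NeZero n := ⟨by omega⟩
  have : Fact (1 < n) := ⟨by omega⟩
  let A : Finset (ZMod n) := {i | π.symm i < π.symm (i - 1)}
  have hA : ∀ i, i ∈ A ↔ π.symm i < π.symm (i - 1) := fun i => by simp [A]
  have hcard : A.card = d := by
    rw [hd, cyclicDescents, ← Set.ncard_coe_finset]
    refine (Set.ncard_congr (fun i _ => i + 1) ?_ ?_ ?_).symm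
    · intro i hi
      simpa [A] using hi
    · intro i j _ _ h
      exact add_right_cancel h
    · intro i hi
      exact ⟨i - 1, by simpa [A] using hi, by ring⟩
  have hne : ∀ i : ZMod n, i - 1 ≠ i := fun i h => by simp at h
  have hpos : 0 < d := by
    rw [← hcard]
    refine Finset.card_pos.mpr ⟨π ⟨0, by omega⟩, (hA _).mpr ?_⟩
    rw [Equiv.symm_apply_apply, Fin.lt_def]
    refine Nat.pos_of_ne_zero fun h => hne (π ⟨0, by omega⟩) ?_
    rw [← π.apply_symm_apply (π ⟨0, by omega⟩ - 1)]
    exact congrArg π (Fin.ext h)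
  have hlt : d < n := by
    rw [← hcard]
    have h1 : A.card < (Finset.univ : Finset (ZMod n)).card := by
      refine Finset.card_lt_card ((Finset.ssubset_univ_iff).mpr fun h => ?_)
      have h2 := (hA (π ⟨n - 1, by omega⟩)).mp (h ▸ Finset.mem_univ _)
      rw [Equiv.symm_apply_apply, Fin.lt_def] at h2
      have h3 := (π.symm (π ⟨n - 1, by omega⟩ - 1)).isLt
      simp only at h2
      omega
    simpa [ZMod.card] using h1
  refine ⟨⟨hpos, hlt⟩, ?_⟩
  have hprod : permutoricPromotion (SimpleGraph.pathGraph n) π =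
      ((List.ofFn π).reverse.map (toggle (SimpleGraph.pathGraph n))).prod := by
    rw [permutoricPromotion, List.map_reverse, List.map_ofFn]
    rfl
  obtain ⟨A', l', h1, h2, h3, h4, h5⟩ := IsArranged.exists_isConj_initial hn
    (SimpleGraph.pathGraph n) d _ A (List.ofFn π).reverse rfl hcard
    (isArranged_ofFn_reverse π A hA)
    (List.nodup_reverse.mpr (List.nodup_ofFn.mpr π.injective))
    (fun x => by simpa [List.mem_ofFn] using π.surjective x)
  rw [hprod]
  refine h5.trans ?_
  have hval := isArranged_initial hn hpos hlt A' h1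
  rw [h2.prod_toggle_eq hn hval]
  rw [List.perm_ext_iff_of_nodup h3]
  · intro x
    refine iff_of_true (h4 x) (List.mem_append.mpr ?_)
    have hx := ZMod.val_lt x
    by_cases hxd : x.val < d
    · exact Or.inr (List.mem_map.mpr ⟨x.val, List.mem_range.mpr hxd, by simp⟩)
    · refine Or.inl (List.mem_map.mpr ⟨n - 1 - x.val, List.mem_range.mpr (by omega), ?_⟩)
      rw [show n - 1 - (n - 1 - x.val) = x.val by omega]
      simp
  · have hinj : ∀ a b : ℕ, a < n → b < n → (a : ZMod n) = b → a = b := fun a b ha hb h => by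
      rw [← ZMod.val_natCast_of_lt ha, ← ZMod.val_natCast_of_lt hb, h]
    refine List.Nodup.append ?_ ?_ ?_
    · refine List.Nodup.map_on ?_ List.nodup_range
      intro a ha b hb h
      rw [List.mem_range] at ha hb
      have := hinj _ _ (by omega) (by omega) h
      omega
    · refine List.Nodup.map_on ?_ List.nodup_range
      intro a ha b hb h
      rw [List.mem_range] at ha hb
      exact hinj _ _ (by omega) (by omega) h
    · intro x hx hy
      obtain ⟨a, ha, rfl⟩ := List.mem_map.mp hx
      obtain ⟨b, hb, h⟩ := List.mem_map.mp hy
      rw [List.mem_range] at ha hb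
      have := hinj _ _ (by omega) (by omega) h
      omega

/-! ### Stones: promotion as two passes of lines -/

theorem Fin.ofNat_succ_eq (k i : ℕ) : Fin.ofNat (k + 1) (i + 1) = Fin.ofNat (k + 1) i + 1 :=
  Fin.ext (by simp [Fin.val_add, Nat.add_mod])

section Grid

variable {M : Type*} [Group M] {p q : ℕ} (B : Fin (p + 1) → Fin (q + 1) → M)

/-- The product of the grid `B` in lexicographic order, column after column. -/
def gridProd {M : Type*} [Monoid M] {p q : ℕ} (B : Fin p → Fin q → M) : M :=
  ((List.finRange p).map fun a => ((List.finRange q).map fun b => B a b).prod).prod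

variable {B} {r s : M}

theorem mul_prod_column (hr : ∀ a b, r * B a b = B (a + 1) b * r) (a : Fin (p + 1))
    (l : List (Fin (q + 1))) :
    r * (l.map fun b => B a b).prod = (l.map fun b => B (a + 1) b).prod * r :=
  semiconjBy_prod_map l fun b _ => hr a b

theorem mul_prod_row (hs : ∀ a b, s * B a b = B a (b + 1) * s) (a : Fin (p + 1))
    (l : List (Fin (q + 1))) :
    s * (l.map fun b => B a b).prod = (l.map fun b => B a (b + 1)).prod * s :=
  semiconjBy_prod_map l fun b _ => hs a b

/-- An element that shifts the columns of the grid cyclically turns the power of a single column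
into the product of all columns. -/
theorem column_mul_pow (hr : ∀ a b, r * B a b = B (a + 1) b * r) :
    (((List.finRange (q + 1)).map fun b => B 0 b).prod * r) ^ (p + 1) =
      gridProd B * r ^ (p + 1) := by
  have h1 : ∀ k : ℕ, r ^ k * ((List.finRange (q + 1)).map fun b => B 0 b).prod =
      ((List.finRange (q + 1)).map fun b => B (Fin.ofNat (p + 1) k) b).prod * r ^ k := by
    intro k
    induction k with
    | zero => simp
    | succ k ih =>
      rw [pow_succ', mul_assoc, ih, ← mul_assoc, mul_prod_column hr, mul_assoc,
        Fin.ofNat_succ_eq]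
  have h2 : ∀ k : ℕ, (((List.finRange (q + 1)).map fun b => B 0 b).prod * r) ^ k =
      ((List.range k).map fun i : ℕ => ((List.finRange (q + 1)).map fun b =>
        B (Fin.ofNat (p + 1) i) b).prod).prod * r ^ k := by
    intro k
    induction k with
    | zero => simp
    | succ k ih =>
      rw [pow_succ, ih, List.range_succ, List.map_append, List.prod_append, List.map_singleton,
        List.prod_singleton, mul_assoc, ← mul_assoc (r ^ k), h1, pow_succ]
      simp only [mul_assoc]
  rw [h2, gridProd, ← List.map_coe_finRange_eq_range, List.map_map]
  congr 4
  funext a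
  simp

theorem row_mul_pow (hs : ∀ a b, s * B a b = B a (b + 1) * s)
    (hB : ∀ a a' b b', a ≠ a' → b ≠ b' → Commute (B a b) (B a' b')) :
    (((List.finRange (p + 1)).map fun a => B a 0).prod * s) ^ (q + 1) =
      gridProd B * s ^ (q + 1) := by
  rw [column_mul_pow (B := fun b a => B a b) fun b a => hs a b]
  congr 1
  exact (prod_map_prod_map_comm B hB _ _ (List.nodup_finRange _) (List.nodup_finRange _)).symm

theorem commute_row_column (hr : ∀ a b, r * B a b = B (a + 1) b * r)
    (hs : ∀ a b, s * B a b = B a (b + 1) * s) (hrs : Commute r s)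
    (hB : ∀ a a' b b', a ≠ a' → b ≠ b' → Commute (B a b) (B a' b')) :
    Commute (((List.finRange (q + 1)).map fun b => B 0 b).prod * r)
      (((List.finRange (p + 1)).map fun a => B a 0).prod * s) := by
  have h1 : r * ((List.finRange (p + 1)).map fun a => B a 0).prod =
      ((List.finRange (p + 1)).map fun a => B (a + 1) 0).prod * r :=
    mul_prod_row (B := fun b a => B a b) (fun b a => hr a b) 0 _
  have h2 := mul_prod_row hs 0 (List.finRange (q + 1))
  have h3 : ∀ (k : ℕ) (f : Fin (k + 1) → M), ((List.finRange (k + 1)).map f).prod =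
      f 0 * ((List.finRange k).map fun a => f a.succ).prod := by
    intro k f
    rw [List.finRange_succ]
    simp [Function.comp_def]
  have h4 : ∀ (k : ℕ) (f : Fin (k + 1) → M), ((List.finRange (k + 1)).map fun a => f (a + 1)).prod =
      ((List.finRange k).map fun a => f a.succ).prod * f 0 := by
    intro k f
    rw [List.finRange_succ_last]
    simp [Function.comp_def]
  have h5 : Commute ((List.finRange q).map fun b => B 0 b.succ).prod
      ((List.finRange p).map fun a => B a.succ 0).prod := by
    refine Commute.list_prod_right _ _ fun y hy => Commute.list_prod_left _ _ fun x hx => ?_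
    obtain ⟨a, -, rfl⟩ := List.mem_map.mp hy
    obtain ⟨b, -, rfl⟩ := List.mem_map.mp hx
    exact hB _ _ _ _ (Fin.succ_ne_zero _).symm (Fin.succ_ne_zero _)
  calc _ = ((List.finRange (q + 1)).map fun b => B 0 b).prod *
        (r * ((List.finRange (p + 1)).map fun a => B a 0).prod) * s := by simp only [mul_assoc]
    _ = ((List.finRange (p + 1)).map fun a => B a 0).prod *
        (s * ((List.finRange (q + 1)).map fun b => B 0 b).prod) * r := by
      rw [h1, h2, h4 p fun a => B a 0, h4 q fun b => B 0 b, h3 q, h3 p]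
      simp only [mul_assoc]
      rw [hrs.eq]
      congr 1
      rw [← mul_assoc, h5.eq, mul_assoc]
    _ = _ := by simp only [mul_assoc]

end Grid

theorem hopChain_map_range {V X : Type*} [DecidableEq X] (G : SimpleGraph V) (f : ℕ → X) (k : ℕ) :
    hopChain G ((List.range (k + 1)).map f) =
      ((List.range k).map fun j => hop G (f j) (f (j + 1))).prod := by
  induction k generalizing f with
  | zero => rfl
  | succ k ih =>
    have h : (List.range (k + 1 + 1)).map f = f 0 :: f 1 :: (List.range k).map fun j => f (j + 2) := by
      rw [List.range_succ_eq_map, List.range_succ_eq_map]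
      simp [Function.comp_def]
    have h' : (List.range (k + 1)).map (fun j => f (j + 1)) =
        f 1 :: (List.range k).map fun j => f (j + 2) := by
      rw [List.range_succ_eq_map]
      simp [Function.comp_def]
    rw [h, hopChain, ← h', ih, List.range_succ_eq_map]
    simp [Function.comp_def]

/-- The lines of the standard order of the toggles, named by their initial positions on the cycle:
`inl a` is the right-moving line that starts at `a`, and `inr b` the left-moving line that starts
at `-1 - b`. -/
noncomputable def linePos (p q : ℕ) : Fin (p + 1) ⊕ Fin (q + 1) ≃ ZMod (p + 1 + (q + 1)) :=
  Equiv.ofBijective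
    (Sum.elim (fun a => (a.val : ZMod (p + 1 + (q + 1)))) fun b => -((b.val + 1 : ℕ) : ZMod _)) (by
    rw [Fintype.bijective_iff_surjective_and_card]
    refine ⟨fun x => ?_, by simp [ZMod.card]⟩
    have hx := ZMod.val_lt x
    by_cases h : x.val < p + 1
    · exact ⟨Sum.inl ⟨x.val, h⟩, by simp⟩
    · refine ⟨Sum.inr ⟨p + 1 + q - x.val, by omega⟩, ?_⟩
      have h1 : ((p + 1 + q - x.val + 1 : ℕ) : ZMod (p + 1 + (q + 1))) + x = 0 := by
        have h2 : ((p + 1 + q - x.val + 1 + x.val : ℕ) : ZMod (p + 1 + (q + 1))) = 0 := by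
          rw [show p + 1 + q - x.val + 1 + x.val = p + 1 + (q + 1) by omega]
          exact ZMod.natCast_self _
        rw [Nat.cast_add] at h2
        simpa using h2
      simp only [Sum.elim_inr]
      rw [neg_eq_iff_add_eq_zero.mpr h1])

theorem linePos_inl {p q : ℕ} (a : Fin (p + 1)) : linePos p q (Sum.inl a) = (a.val : ZMod _) := rfl

theorem linePos_inr {p q : ℕ} (b : Fin (q + 1)) :
    linePos p q (Sum.inr b) = -((b.val + 1 : ℕ) : ZMod _) := rfl

/-- The standard order of the toggles, as two chains of hops between lines. -/
theorem prod_toggle_standard {V : Type*} (G : SimpleGraph V) (p q : ℕ) :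
    ((((List.range (q + 1)).map fun j : ℕ => ((p + 1 + (q + 1) - 1 - j : ℕ) :
        ZMod (p + 1 + (q + 1)))) ++ (List.range (p + 1)).map fun j : ℕ =>
          (j : ZMod (p + 1 + (q + 1)))).map (toggle G)).prod =
      ((Equiv.refl V).equivCongr (linePos p q)).permCongr
        (hopChain G (Sum.inl 0 :: (List.finRange (q + 1)).map Sum.inr) *
          hopChain G ((List.finRange (p + 1)).map Sum.inl ++ [Sum.inr (Fin.last q)])) := by
  have hmul : ∀ x y : Equiv.Perm (V ≃ Fin (p + 1) ⊕ Fin (q + 1)),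
      ((Equiv.refl V).equivCongr (linePos p q)).permCongr (x * y) =
      ((Equiv.refl V).equivCongr (linePos p q)).permCongr x *
        ((Equiv.refl V).equivCongr (linePos p q)).permCongr y :=
    fun x y => map_mul ((Equiv.refl V).equivCongr (linePos p q)).permCongrHom x y
  have e1 : (Sum.inl 0 :: (List.finRange (q + 1)).map Sum.inr : List
      (Fin (p + 1) ⊕ Fin (q + 1))).map (linePos p q) =
      (List.range (q + 1 + 1)).map fun j : ℕ => -(j : ZMod (p + 1 + (q + 1))) := by
    rw [List.range_succ_eq_map, ← List.map_coe_finRange_eq_range (n := q + 1)]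
    simp only [List.map_cons, List.map_map]
    congr 1
    simp [linePos_inl]
  have e2 : ((List.finRange (p + 1)).map Sum.inl ++ [Sum.inr (Fin.last q)] : List
      (Fin (p + 1) ⊕ Fin (q + 1))).map (linePos p q) =
      (List.range (p + 1 + 1)).map fun j : ℕ => (j : ZMod (p + 1 + (q + 1))) := by
    rw [List.range_succ (n := p + 1), ← List.map_coe_finRange_eq_range (n := p + 1)]
    simp only [List.map_append, List.map_map, List.map_singleton]
    congr 2
    rw [linePos_inr, neg_eq_iff_add_eq_zero, Fin.val_last, ← Nat.cast_add, add_comm]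
    exact ZMod.natCast_self _
  rw [hmul, permCongr_hopChain, permCongr_hopChain, e1, e2, hopChain_map_range, hopChain_map_range,
    List.map_append, List.prod_append, List.map_map, List.map_map]
  congr 2
  · refine List.map_congr_left fun j hj => ?_
    rw [List.mem_range] at hj
    have h : ((p + 1 + (q + 1) - 1 - j : ℕ) : ZMod (p + 1 + (q + 1))) = -((j + 1 : ℕ) : ZMod _) := by
      rw [eq_neg_iff_add_eq_zero, ← Nat.cast_add,
        show p + 1 + (q + 1) - 1 - j + (j + 1) = p + 1 + (q + 1) by omega]
      exact ZMod.natCast_self _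
    rw [Function.comp_apply, h, toggle_eq_hop, hop_comm]
    congr 1
    push_cast
    ring
  · refine List.map_congr_left fun j _ => ?_
    rw [Function.comp_apply, toggle_eq_hop]
    push_cast
    rfl

section Lines

variable {V : Type*} (G : SimpleGraph V) (p q : ℕ)

/-- The cyclic shift of the right-moving lines `inl a`, as an operator on labelings. -/
def shiftInl (V : Type*) (p q : ℕ) : Equiv.Perm (V ≃ Fin (p + 1) ⊕ Fin (q + 1)) :=
  relabel V (Equiv.sumCongr (finRotate (p + 1)) 1)

/-- The cyclic shift of the left-moving lines `inr b`, as an operator on labelings. -/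
def shiftInr (V : Type*) (p q : ℕ) : Equiv.Perm (V ≃ Fin (p + 1) ⊕ Fin (q + 1)) :=
  relabel V (Equiv.sumCongr 1 (finRotate (q + 1)))

/-- A right-moving line passes all left-moving lines, and the right-moving lines are renumbered
cyclically. The shift acts first here; if it acted last, the passing line would be `inl (last p)`
instead of `inl 0`. -/
noncomputable def passColumn : Equiv.Perm (V ≃ Fin (p + 1) ⊕ Fin (q + 1)) :=
  ((List.finRange (q + 1)).map fun b => bounce G (Sum.inl (0 : Fin (p + 1))) (Sum.inr b)).prod *
    shiftInl V p q

/-- A left-moving line passes all right-moving lines, and the left-moving lines are renumbered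
cyclically. -/
noncomputable def passRow : Equiv.Perm (V ≃ Fin (p + 1) ⊕ Fin (q + 1)) :=
  ((List.finRange (p + 1)).map fun a => bounce G (Sum.inl a) (Sum.inr (0 : Fin (q + 1)))).prod *
    shiftInr V p q

variable {p q}

theorem shiftInl_mul_bounce (a : Fin (p + 1)) (b : Fin (q + 1)) :
    shiftInl V p q * bounce G (Sum.inl a) (Sum.inr b) =
      bounce G (Sum.inl (a + 1)) (Sum.inr b) * shiftInl V p q := by
  rw [shiftInl, relabel_mul_bounce]
  simp

theorem shiftInr_mul_bounce (a : Fin (p + 1)) (b : Fin (q + 1)) :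
    shiftInr V p q * bounce G (Sum.inl a) (Sum.inr b) =
      bounce G (Sum.inl a) (Sum.inr (b + 1)) * shiftInr V p q := by
  rw [shiftInr, relabel_mul_bounce]
  simp

theorem commute_bounce_inl_inr {α β : Type*} [DecidableEq α] [DecidableEq β] {a a' : α}
    {b b' : β} (ha : a ≠ a') (hb : b ≠ b') :
    Commute (bounce G (Sum.inl a) (Sum.inr b)) (bounce G (Sum.inl a') (Sum.inr b')) :=
  commute_bounce G (by simpa using ha.symm) (by simp) (by simp) (by simpa using hb.symm)

theorem finRotate_pow_apply (k j : ℕ) (i : Fin (k + 1)) :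
    (finRotate (k + 1) ^ j) i = i + Fin.ofNat (k + 1) j := by
  induction j generalizing i with
  | zero => simp
  | succ j ih =>
    rw [pow_succ', Equiv.Perm.mul_apply, ih, finRotate_apply, Fin.ofNat_succ_eq, add_assoc]

theorem finRotate_succ_pow (k : ℕ) : finRotate (k + 1) ^ (k + 1) = 1 := by
  ext1 i
  rw [finRotate_pow_apply]
  simp

theorem shiftInl_pow : shiftInl V p q ^ (p + 1) = 1 := by
  have : Equiv.sumCongr (finRotate (p + 1)) (1 : Equiv.Perm (Fin (q + 1))) ^ (p + 1) = 1 := by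
    have := map_pow (Equiv.Perm.sumCongrHom (Fin (p + 1)) (Fin (q + 1))) (finRotate (p + 1), 1) (p + 1)
    rw [Prod.pow_mk, finRotate_succ_pow, one_pow] at this
    exact this.symm.trans (map_one _)
  rw [shiftInl, ← map_pow, this, map_one]

theorem shiftInr_pow : shiftInr V p q ^ (q + 1) = 1 := by
  have : Equiv.sumCongr (1 : Equiv.Perm (Fin (p + 1))) (finRotate (q + 1)) ^ (q + 1) = 1 := by
    have := map_pow (Equiv.Perm.sumCongrHom (Fin (p + 1)) (Fin (q + 1))) (1, finRotate (q + 1)) (q + 1)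
    rw [Prod.pow_mk, finRotate_succ_pow, one_pow] at this
    exact this.symm.trans (map_one _)
  rw [shiftInr, ← map_pow, this, map_one]

theorem commute_passColumn_passRow : Commute (passColumn G p q) (passRow G p q) := by
  refine commute_row_column (B := fun a b => bounce G (Sum.inl a) (Sum.inr b))
    (shiftInl_mul_bounce G) (shiftInr_mul_bounce G) ?_ fun a a' b b' => commute_bounce_inl_inr G
  refine Commute.map ?_ (relabel V)
  ext1 x
  cases x <;> rfl

theorem passColumn_pow : passColumn G p q ^ (p + 1) =
    gridProd fun a b => bounce G (Sum.inl a) (Sum.inr b) := by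
  rw [passColumn, column_mul_pow (B := fun a b => bounce G (Sum.inl a) (Sum.inr b))
    (shiftInl_mul_bounce G), shiftInl_pow, mul_one]

theorem passRow_pow : passRow G p q ^ (q + 1) =
    gridProd fun a b => bounce G (Sum.inl a) (Sum.inr b) := by
  rw [passRow, row_mul_pow (B := fun a b => bounce G (Sum.inl a) (Sum.inr b))
    (shiftInr_mul_bounce G) fun a a' b b' => commute_bounce_inl_inr G, shiftInr_pow, mul_one]

/-- The powers of standard promotion that act trivially on the lines are powers of the product of
all bounces. -/
theorem passColumn_mul_passRow_pow {k : ℕ} (hp : p + 1 ∣ k) (hq : q + 1 ∣ k) :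
    (passColumn G p q * passRow G p q) ^ k =
      (gridProd fun a b => bounce G (Sum.inl a) (Sum.inr b)) ^
        (k / (p + 1) + k / (q + 1)) := by
  rw [(commute_passColumn_passRow G).mul_pow, pow_add]
  congr 1
  · rw [← passColumn_pow, ← pow_mul, Nat.mul_div_cancel' hp]
  · rw [← passRow_pow, ← pow_mul, Nat.mul_div_cancel' hq]

/-- Standard promotion consists of two passes: in the first chain of hops to act, the left-moving
line `inr (last q)` travels past all right-moving lines, in the second one the right-moving line
`inl (last p)` travels past all left-moving lines. -/
theorem hopChain_mul_hopChain :
    hopChain G (Sum.inl 0 :: (List.finRange (q + 1)).map Sum.inr) *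
          hopChain G ((List.finRange (p + 1)).map Sum.inl ++ [Sum.inr (Fin.last q)]) =
      passColumn G p q * passRow G p q := by
  have hinl : Function.Injective (Sum.inl : Fin (p + 1) → Fin (p + 1) ⊕ Fin (q + 1)) :=
    Sum.inl_injective
  have hinr : Function.Injective (Sum.inr : Fin (q + 1) → Fin (p + 1) ⊕ Fin (q + 1)) :=
    Sum.inr_injective
  set x1 : List (Fin (p + 1) ⊕ Fin (q + 1)) :=
    (List.finRange (p + 1)).map Sum.inl ++ [Sum.inr (Fin.last q)] with hx1
  set x2 : List (Fin (p + 1) ⊕ Fin (q + 1)) := Sum.inl 0 :: (List.finRange (q + 1)).map Sum.inr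
    with hx2
  have hn1 : x1.Nodup := by
    rw [hx1]
    refine List.Nodup.append ((List.nodup_finRange _).map hinl) (List.nodup_singleton _) ?_
    intro x hx hx'
    rw [List.mem_singleton] at hx'
    simp [hx'] at hx
  have hn2 : x2.Nodup := by
    rw [hx2, List.nodup_cons]
    exact ⟨by simp, (List.nodup_finRange _).map hinr⟩
  have hx2' : x2 = (Sum.inl 0 :: (List.finRange q).map fun b => Sum.inr b.castSucc) ++
      [Sum.inr (Fin.last q)] := by
    rw [hx2, List.finRange_succ_last]
    simp [Function.comp_def]
  -- the cyclic permutations of the lines behind the two chains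
  have l1 : x1.length = p + 2 := by simp [hx1]
  have l2 : x2.length = q + 2 := by simp [hx2]
  have g1 : ∀ a : Fin (p + 1), x1[a.val]'(by omega) = Sum.inl a := by
    intro a
    have := a.isLt
    simp [hx1, Nat.lt_succ_iff.mp this]
  have g1' : x1[p + 1]'(by omega) = Sum.inr (Fin.last q) := by
    simp [hx1]
  have g2 : x2[0]'(by omega) = Sum.inl 0 := by simp [hx2]
  have g2' : ∀ b : Fin (q + 1), x2[b.val + 1]'(by omega) = Sum.inr b := by
    intro b
    simp [hx2]
  have step : ∀ (x : List (Fin (p + 1) ⊕ Fin (q + 1))) (hx : x.Nodup) (i : ℕ) (h : i + 1 < x.length),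
      x.formPerm (x[i]'(by omega)) = x[i + 1] := fun x hx i h => List.formPerm_apply_lt_getElem x hx i h
  have F1a : ∀ a : Fin p, x1.formPerm (Sum.inl a.castSucc) = Sum.inl a.succ := by
    intro a
    rw [← g1, ← g1]
    exact step x1 hn1 a.val (by omega)
  have F1b : x1.formPerm (Sum.inl (Fin.last p)) = Sum.inr (Fin.last q) := by
    rw [← g1, ← g1']
    exact step x1 hn1 p (by omega)
  have F1c : x1.formPerm (Sum.inr (Fin.last q)) = Sum.inl 0 := by
    have h := List.formPerm_apply_getElem x1 hn1 (p + 1) (by omega)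
    simp only [l1, Nat.mod_self, g1'] at h
    rw [h]
    exact g1 0
  have F1d : ∀ b : Fin q, x1.formPerm (Sum.inr b.castSucc) = Sum.inr b.castSucc := by
    intro b
    refine List.formPerm_apply_of_notMem ?_
    simp [hx1, b.castSucc_lt_last.ne]
  have F2a : x2.formPerm (Sum.inl 0) = Sum.inr 0 := by
    rw [← g2, ← g2']
    exact step x2 hn2 0 (by omega)
  have F2b : ∀ b : Fin q, x2.formPerm (Sum.inr b.castSucc) = Sum.inr b.succ := by
    intro b
    rw [← g2', ← g2']
    exact step x2 hn2 (b.val + 1) (by omega)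
  have F2c : x2.formPerm (Sum.inr (Fin.last q)) = Sum.inl 0 := by
    have h := List.formPerm_apply_getElem x2 hn2 (q + 1) (by omega)
    have g := g2' (Fin.last q)
    simp only [Fin.val_last] at g
    simp only [l2, Nat.mod_self, g] at h
    rw [h]
    exact g2
  have F2d : ∀ a : Fin p, x2.formPerm (Sum.inl a.succ) = Sum.inl a.succ := by
    intro a
    refine List.formPerm_apply_of_notMem ?_
    simp [hx2]
  have hF : x2.formPerm * x1.formPerm =
      Equiv.sumCongr (finRotate (p + 1)) 1 * Equiv.sumCongr 1 (finRotate (q + 1)) := by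
    ext1 x
    rw [Equiv.Perm.mul_apply, Equiv.Perm.mul_apply]
    rcases x with a | b
    · induction a using Fin.lastCases with
      | last => rw [F1b, F2c]; simp
      | cast a => rw [F1a, F2d]; simp
    · induction b using Fin.lastCases with
      | last => rw [F1c, F2a]; simp
      | cast b => rw [F1d, F2b]; simp
  have hb1 : bounce G (Sum.inl 0) (Sum.inr (Fin.last q)) * relabel V x1.formPerm =
      relabel V x1.formPerm * bounce G (Sum.inl (Fin.last p)) (Sum.inr (Fin.last q)) := by
    rw [relabel_mul_bounce, F1b, F1c, bounce_comm]
  have hb2 : ∀ l : List (Fin q), (l.map fun b => bounce G (Sum.inr b.castSucc)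
        (Sum.inr (Fin.last q))).prod * relabel V x1.formPerm =
      relabel V x1.formPerm * (l.map fun b => bounce G (Sum.inl (Fin.last p))
        (Sum.inr b.castSucc)).prod := by
    intro l
    induction l with
    | nil => simp
    | cons b l ih =>
      have h := relabel_mul_bounce G x1.formPerm (Sum.inl (Fin.last p)) (Sum.inr b.castSucc)
      rw [F1b, F1d, bounce_comm G (Sum.inr (Fin.last q))] at h
      rw [List.map_cons, List.prod_cons, mul_assoc, ih, ← mul_assoc, ← h, List.map_cons,
        List.prod_cons, mul_assoc]
  have h1 := hopChain_append_singleton G _ _ (hx1 ▸ hn1)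
  have h2 := hopChain_append_singleton G _ _ (hx2' ▸ hn2)
  rw [← hx1] at h1
  rw [← hx2', List.map_cons, List.prod_cons, List.map_map] at h2
  have hcol : passColumn G p q = shiftInl V p q *
      ((List.finRange (q + 1)).map fun b => bounce G (Sum.inl (Fin.last p)) (Sum.inr b)).prod := by
    rw [mul_prod_column (B := fun a b => bounce G (Sum.inl a) (Sum.inr b))
      (shiftInl_mul_bounce G), Fin.last_add_one, passColumn]
  have hrow : passRow G p q = shiftInr V p q *
      ((List.finRange (p + 1)).map fun a => bounce G (Sum.inl a) (Sum.inr (Fin.last q))).prod := by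
    rw [mul_prod_column (B := fun b a => bounce G (Sum.inl a) (Sum.inr b))
      (fun b a => shiftInr_mul_bounce G a b), Fin.last_add_one, passRow]
  have hshift : ((List.finRange (q + 1)).map fun b => bounce G (Sum.inl (Fin.last p))
        (Sum.inr b)).prod * shiftInr V p q =
      shiftInr V p q * (bounce G (Sum.inl (Fin.last p)) (Sum.inr (Fin.last q)) *
        ((List.finRange q).map fun b => bounce G (Sum.inl (Fin.last p))
          (Sum.inr b.castSucc)).prod) := by
    have h := mul_prod_row (B := fun a b => bounce G (Sum.inl a) (Sum.inr b))
      (shiftInr_mul_bounce G) (Fin.last p) ((List.finRange q).map Fin.castSucc)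
    rw [List.map_map, List.map_map] at h
    rw [← mul_assoc, shiftInr_mul_bounce, mul_assoc]
    refine Eq.trans ?_ (congrArg _ h.symm)
    rw [List.finRange_succ, ← mul_assoc]
    simp [Function.comp_def]
  have hFV := congrArg (relabel V) hF
  rw [map_mul, map_mul] at hFV
  calc _ = relabel V x2.formPerm * (bounce G (Sum.inl 0) (Sum.inr (Fin.last q)) *
        (((List.finRange q).map fun b => bounce G (Sum.inr b.castSucc)
          (Sum.inr (Fin.last q))).prod * relabel V x1.formPerm)) *
        ((List.finRange (p + 1)).map fun a => bounce G (Sum.inl a)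
          (Sum.inr (Fin.last q))).prod := by
        rw [h1, h2, List.map_map]
        simp only [mul_assoc]
        rfl
    _ = (relabel V x2.formPerm * relabel V x1.formPerm) *
        (bounce G (Sum.inl (Fin.last p)) (Sum.inr (Fin.last q)) *
        ((List.finRange q).map fun b => bounce G (Sum.inl (Fin.last p))
          (Sum.inr b.castSucc)).prod) *
        ((List.finRange (p + 1)).map fun a => bounce G (Sum.inl a)
          (Sum.inr (Fin.last q))).prod := by
        rw [hb2, ← mul_assoc (bounce G (Sum.inl 0) _), hb1]
        simp only [mul_assoc]
    _ = shiftInl V p q * (shiftInr V p q *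
        (bounce G (Sum.inl (Fin.last p)) (Sum.inr (Fin.last q)) *
        ((List.finRange q).map fun b => bounce G (Sum.inl (Fin.last p))
          (Sum.inr b.castSucc)).prod)) *
        ((List.finRange (p + 1)).map fun a => bounce G (Sum.inl a)
          (Sum.inr (Fin.last q))).prod := by
        rw [hFV, shiftInl, shiftInr]
        simp only [mul_assoc]
    _ = _ := by
        rw [← hshift, hcol, hrow]
        simp only [mul_assoc]

end Lines

/-! ### Coins: reduction to sorted labelings -/

section GridOrder

variable {M : Type*} [Group M] {d m : ℕ} {B : Fin d → Fin m → M}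

/-- If entries of the grid that are not neighbours commute, then permuting the columns and the
rows does not change the conjugacy class of the product of the grid. -/
theorem isConj_gridProd_perm (hB : ∀ a a' b b', a ≠ a' → b ≠ b' → Commute (B a b) (B a' b'))
    (hrow : ∀ (a a' : Fin d) b, a.val + 1 < a'.val → Commute (B a b) (B a' b))
    (hcol : ∀ a (b b' : Fin m), b.val + 1 < b'.val → Commute (B a b) (B a b'))
    (g : Equiv.Perm (Fin d)) (h : Equiv.Perm (Fin m)) :
    IsConj (gridProd fun a b => B (g a) (h b)) (gridProd B) := by
  have hcomm : ∀ {k : ℕ} {x y : Fin k}, x.val + 1 < y.val → x ≠ y := by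
    rintro k x y hxy rfl
    omega
  have h1 : IsConj (gridProd fun a b => B (g a) (h b)) (gridProd fun a b => B a (h b)) := by
    refine isConj_prod_map_finRange
      (fun a => ((List.finRange m).map fun b => B a (h b)).prod) (fun a a' haa => ?_) g
    refine Commute.list_prod_right _ _ fun y hy => Commute.list_prod_left _ _ fun x hx => ?_
    obtain ⟨b, -, rfl⟩ := List.mem_map.mp hx
    obtain ⟨b', -, rfl⟩ := List.mem_map.mp hy
    by_cases hb : b = b'
    · rw [hb]
      exact hrow a a' _ haa
    · exact hB _ _ _ _ (hcomm haa) fun hh => hb (h.injective hh)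
  have h2 : IsConj ((List.finRange m).map fun b => ((List.finRange d).map fun a =>
      B a (h b)).prod).prod ((List.finRange m).map fun b => ((List.finRange d).map fun a =>
      B a b).prod).prod := by
    refine isConj_prod_map_finRange
      (fun b => ((List.finRange d).map fun a => B a b).prod) (fun b b' hbb => ?_) h
    refine Commute.list_prod_right _ _ fun y hy => Commute.list_prod_left _ _ fun x hx => ?_
    obtain ⟨a, -, rfl⟩ := List.mem_map.mp hx
    obtain ⟨a', -, rfl⟩ := List.mem_map.mp hy
    by_cases ha : a = a'
    · rw [ha]
      exact hcol _ _ _ hbb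
    · exact hB _ _ _ _ ha (hcomm hbb)
  have e1 : (gridProd fun a b => B a (h b)) = ((List.finRange m).map fun b =>
      ((List.finRange d).map fun a => B a (h b)).prod).prod :=
    prod_map_prod_map_comm (fun a b => B a (h b))
      (fun a a' b b' ha hb => hB _ _ _ _ ha fun hh => hb (h.injective hh)) _ _
      (List.nodup_finRange _) (List.nodup_finRange _)
  have e2 : gridProd B = ((List.finRange m).map fun b =>
      ((List.finRange d).map fun a => B a b).prod).prod :=
    prod_map_prod_map_comm B hB _ _ (List.nodup_finRange _) (List.nodup_finRange _)
  rw [e1] at h1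
  rw [e2]
  exact h1.trans h2

end GridOrder

section Path

variable {n : ℕ}

theorem lt_iff_lt_of_pathGraph_adj {u v w : Fin n} (h : (SimpleGraph.pathGraph n).Adj u v)
    (hu : w ≠ u) (hv : w ≠ v) : (u < w ↔ v < w) ∧ (w < u ↔ w < v) := by
  rw [SimpleGraph.pathGraph_adj] at h
  omega

/-- A bounce of `x` and `y` does not change the order of any other two vertices. -/
theorem bounce_symm_lt_iff {X : Type*} [DecidableEq X] {x y z w : X} (σ : Fin n ≃ X)
    (h : ¬ (z = x ∧ w = y)) (h' : ¬ (z = y ∧ w = x)) :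
    (bounce (SimpleGraph.pathGraph n) x y σ).symm z <
        (bounce (SimpleGraph.pathGraph n) x y σ).symm w ↔ σ.symm z < σ.symm w := by
  by_cases hadj : (SimpleGraph.pathGraph n).Adj (σ.symm x) (σ.symm y)
  · have hne : ∀ {s t : X}, s ≠ t → σ.symm s ≠ σ.symm t := fun hst h => hst (σ.symm.injective h)
    rw [bounce_apply_of_adj _ hadj]
    have e : ∀ t, (σ.trans (Equiv.swap x y)).symm t = σ.symm (Equiv.swap x y t) := fun t => by simp
    rw [e, e]
    by_cases hzw : z = w
    · simp [hzw]
    by_cases hzx : z = x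
    · subst hzx
      have hwy : w ≠ y := fun hw => h ⟨rfl, hw⟩
      rw [Equiv.swap_apply_left, Equiv.swap_apply_of_ne_of_ne (Ne.symm hzw) hwy]
      exact (lt_iff_lt_of_pathGraph_adj hadj (hne (Ne.symm hzw)) (hne hwy)).1.symm
    by_cases hzy : z = y
    · subst hzy
      have hwx : w ≠ x := fun hw => h' ⟨rfl, hw⟩
      rw [Equiv.swap_apply_right, Equiv.swap_apply_of_ne_of_ne hwx (Ne.symm hzw)]
      exact (lt_iff_lt_of_pathGraph_adj hadj (hne hwx) (hne (Ne.symm hzw))).1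
    rw [Equiv.swap_apply_of_ne_of_ne hzx hzy]
    by_cases hwx : w = x
    · subst hwx
      rw [Equiv.swap_apply_left]
      exact (lt_iff_lt_of_pathGraph_adj hadj (hne hzx) (hne hzy)).2.symm
    by_cases hwy : w = y
    · subst hwy
      rw [Equiv.swap_apply_right]
      exact (lt_iff_lt_of_pathGraph_adj hadj (hne hzx) (hne hzy)).2
    rw [Equiv.swap_apply_of_ne_of_ne hwx hwy]
  · rw [bounce_apply_of_not_adj _ hadj]

/-- Two bounces with a common label `x` commute on a labeling in which `x` is not adjacent to both
other labels, and these are not adjacent to each other. -/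
theorem bounce_bounce_comm {V X : Type*} [DecidableEq X] (G : SimpleGraph V) {x y z : X}
    (hxy : x ≠ y) (hxz : x ≠ z) (hyz : y ≠ z) {σ : V ≃ X}
    (h : ¬ (G.Adj (σ.symm x) (σ.symm y) ∧ G.Adj (σ.symm x) (σ.symm z)))
    (h' : ¬ G.Adj (σ.symm y) (σ.symm z)) :
    bounce G x y (bounce G x z σ) = bounce G x z (bounce G x y σ) := by
  have key : ∀ y z : X, x ≠ y → x ≠ z → y ≠ z → ¬ G.Adj (σ.symm y) (σ.symm z) →
      G.Adj (σ.symm x) (σ.symm y) →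
      bounce G x z (bounce G x y σ) = bounce G x y σ := by
    intro y z hxy hxz hyz h1 h2
    refine bounce_apply_of_not_adj G ?_
    rw [bounce_symm_apply_of_ne G hxz.symm hyz.symm, bounce_apply_of_adj G h2]
    simpa using h1
  by_cases h1 : G.Adj (σ.symm x) (σ.symm y)
  · rw [key y z hxy hxz hyz h' h1, bounce_apply_of_not_adj G fun h2 => h ⟨h1, h2⟩]
  · rw [bounce_apply_of_not_adj G h1]
    by_cases h2 : G.Adj (σ.symm x) (σ.symm z)
    · exact key z y hxz hxy hyz.symm (fun h3 => h' h3.symm) h2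
    · rw [bounce_apply_of_not_adj G h2, bounce_apply_of_not_adj G h1]

variable {d m : ℕ}

/-- A labeling of the path by the disjoint union of two chains is sorted if the labels from each
chain increase along the path. -/
def IsSorted (σ : Fin n ≃ Fin d ⊕ Fin m) : Prop :=
  (StrictMono fun a => σ.symm (Sum.inl a)) ∧ StrictMono fun b => σ.symm (Sum.inr b)

theorem isSorted_bounce_iff (σ : Fin n ≃ Fin d ⊕ Fin m) (a : Fin d) (b : Fin m) :
    IsSorted (bounce (SimpleGraph.pathGraph n) (Sum.inl a) (Sum.inr b) σ) ↔ IsSorted σ := by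
  unfold IsSorted StrictMono
  refine and_congr ?_ ?_
  · refine forall_congr' fun x => forall_congr' fun y => imp_congr_right fun _ => ?_
    exact bounce_symm_lt_iff σ (by simp) (by simp)
  · refine forall_congr' fun x => forall_congr' fun y => imp_congr_right fun _ => ?_
    exact bounce_symm_lt_iff σ (by simp) (by simp)

/-- The bounce of `inl a` and `inr b`, restricted to the sorted labelings. -/
noncomputable def sortedBounce (n : ℕ) {d m : ℕ} (a : Fin d) (b : Fin m) :
    Equiv.Perm {σ : Fin n ≃ Fin d ⊕ Fin m // IsSorted σ} :=
  (bounce (SimpleGraph.pathGraph n) (Sum.inl a) (Sum.inr b)).subtypePerm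
    fun σ => isSorted_bounce_iff σ a b

theorem coe_sortedBounce (a : Fin d) (b : Fin m) (σ : {σ : Fin n ≃ Fin d ⊕ Fin m // IsSorted σ}) :
    (sortedBounce n a b σ : Fin n ≃ Fin d ⊕ Fin m) =
      bounce (SimpleGraph.pathGraph n) (Sum.inl a) (Sum.inr b) σ := rfl

theorem commute_sortedBounce {a a' : Fin d} {b b' : Fin m} (ha : a ≠ a') (hb : b ≠ b') :
    Commute (sortedBounce n a b) (sortedBounce n a' b') := by
  ext1 σ
  refine Subtype.ext ?_
  exact congrArg (fun f => f σ.1) (commute_bounce_inl_inr (SimpleGraph.pathGraph n) ha hb).eq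

theorem not_pathGraph_adj_of_between {u v w : Fin n} (h1 : u < v) (h2 : v < w) :
    ¬ (SimpleGraph.pathGraph n).Adj u w := by
  rw [SimpleGraph.pathGraph_adj]
  omega

theorem eq_of_pathGraph_adj_of_between {u v w x : Fin n} (h1 : u < v) (h2 : v < w)
    (h3 : (SimpleGraph.pathGraph n).Adj x u) (h4 : (SimpleGraph.pathGraph n).Adj x w) : x = v := by
  rw [SimpleGraph.pathGraph_adj] at h3 h4
  omega

/-- The label `inl (a + 1)` lies between `inl a` and `inl a'`, so `inr b` cannot be adjacent to
both of them. -/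
theorem commute_sortedBounce_row {a a' : Fin d} (b : Fin m) (h : a.val + 1 < a'.val) :
    Commute (sortedBounce n a b) (sortedBounce n a' b) := by
  ext1 ⟨σ, hσ⟩
  refine Subtype.ext ?_
  have h1 : σ.symm (Sum.inl a) < σ.symm (Sum.inl ⟨a.val + 1, by omega⟩) :=
    hσ.1 (Fin.lt_def.mpr (Nat.lt_succ_self _))
  have h2 : σ.symm (Sum.inl ⟨a.val + 1, by omega⟩) < σ.symm (Sum.inl a') := hσ.1 (Fin.lt_def.mpr h)
  rw [Equiv.Perm.mul_apply, Equiv.Perm.mul_apply, coe_sortedBounce, coe_sortedBounce,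
    coe_sortedBounce, coe_sortedBounce, bounce_comm _ (Sum.inl a), bounce_comm _ (Sum.inl a')]
  refine bounce_bounce_comm _ (by simp) (by simp) ?_ ?_ (not_pathGraph_adj_of_between h1 h2)
  · simp only [ne_eq, Sum.inl.injEq]
    omega
  · rintro ⟨h3, h4⟩
    have := σ.symm.injective (eq_of_pathGraph_adj_of_between h1 h2 h3 h4)
    simp at this

theorem commute_sortedBounce_column (a : Fin d) {b b' : Fin m} (h : b.val + 1 < b'.val) :
    Commute (sortedBounce n a b) (sortedBounce n a b') := by
  ext1 ⟨σ, hσ⟩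
  refine Subtype.ext ?_
  have h1 : σ.symm (Sum.inr b) < σ.symm (Sum.inr ⟨b.val + 1, by omega⟩) :=
    hσ.2 (Fin.lt_def.mpr (Nat.lt_succ_self _))
  have h2 : σ.symm (Sum.inr ⟨b.val + 1, by omega⟩) < σ.symm (Sum.inr b') := hσ.2 (Fin.lt_def.mpr h)
  rw [Equiv.Perm.mul_apply, Equiv.Perm.mul_apply, coe_sortedBounce, coe_sortedBounce,
    coe_sortedBounce, coe_sortedBounce]
  refine bounce_bounce_comm _ (by simp) (by simp) ?_ ?_ (not_pathGraph_adj_of_between h1 h2)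
  · simp only [ne_eq, Sum.inr.injEq]
    omega
  · rintro ⟨h3, h4⟩
    have := σ.symm.injective (eq_of_pathGraph_adj_of_between h1 h2 h3 h4)
    simp at this

theorem strictMono_perm_eq_one {k : ℕ} {α : Type*} [LinearOrder α] {f : Fin k → α}
    (hf : StrictMono f) (g : Equiv.Perm (Fin k)) (hg : StrictMono (f ∘ g)) : g = 1 := by
  have h : StrictMono g := fun x y hxy => hf.lt_iff_lt.mp (hg hxy)
  have := Subsingleton.elim (StrictMono.orderIsoOfSurjective g h g.surjective) (OrderIso.refl _)
  ext1 x
  exact congrArg (fun e : Fin k ≃o Fin k => e x) this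

/-- Every labeling arises from exactly one sorted labeling by permuting the labels within the
two chains. -/
theorem bijective_relabel_sorted (n d m : ℕ) : Function.Bijective
    fun x : (Equiv.Perm (Fin d) × Equiv.Perm (Fin m)) ×
      {σ : Fin n ≃ Fin d ⊕ Fin m // IsSorted σ} =>
        relabel (Fin n) (Equiv.sumCongr x.1.1 x.1.2) x.2.1 := by
  constructor
  · rintro ⟨⟨g, h⟩, σ, hσ⟩ ⟨⟨g', h'⟩, σ', hσ'⟩ heq
    have heq' : ∀ z, σ.symm (Equiv.sumCongr g⁻¹ h⁻¹ z) = σ'.symm (Equiv.sumCongr g'⁻¹ h'⁻¹ z) :=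
      fun z => congrArg (fun τ : Fin n ≃ Fin d ⊕ Fin m => τ.symm z) heq
    have hg : g⁻¹ * g' = 1 := by
      refine strictMono_perm_eq_one hσ.1 _ ?_
      convert hσ'.1 using 2 with a
      simpa using heq' (Sum.inl (g' a))
    have hh : h⁻¹ * h' = 1 := by
      refine strictMono_perm_eq_one hσ.2 _ ?_
      convert hσ'.2 using 2 with a
      simpa using heq' (Sum.inr (h' a))
    obtain rfl := inv_mul_eq_one.mp hg
    obtain rfl := inv_mul_eq_one.mp hh
    have := (relabel (Fin n) (Equiv.sumCongr g h)).injective heq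
    subst this
    rfl
  · intro τ
    let g := Tuple.sort fun a => τ.symm (Sum.inl a)
    let h := Tuple.sort fun b => τ.symm (Sum.inr b)
    have hinj : ∀ {x y}, τ.symm x = τ.symm y → x = y := fun h => τ.symm.injective h
    refine ⟨⟨⟨g, h⟩, relabel (Fin n) (Equiv.sumCongr g⁻¹ h⁻¹) τ, ?_, ?_⟩, ?_⟩
    · refine Monotone.strictMono_of_injective (Tuple.monotone_sort fun a => τ.symm (Sum.inl a)) ?_
      intro x y hxy
      simpa using hinj hxy
    · refine Monotone.strictMono_of_injective (Tuple.monotone_sort fun b => τ.symm (Sum.inr b)) ?_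
      intro x y hxy
      simpa using hinj hxy
    · ext v
      simp only [relabel_apply, Equiv.trans_apply]
      cases τ v <;> simp

theorem coe_prod_map {L ι : Type*} {P : L → Prop} {f : ι → Equiv.Perm {x // P x}}
    {F : ι → Equiv.Perm L} (h : ∀ i x, (f i x : L) = F i x) (l : List ι) (x : {x // P x}) :
    ((l.map f).prod x : L) = (l.map F).prod x := by
  induction l with
  | nil => rfl
  | cons i l ih =>
    rw [List.map_cons, List.prod_cons, Equiv.Perm.mul_apply, h, ih, List.map_cons, List.prod_cons,
      Equiv.Perm.mul_apply]

theorem coe_gridProd_sortedBounce (g : Fin d → Fin d) (h : Fin m → Fin m)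
    (σ : {σ : Fin n ≃ Fin d ⊕ Fin m // IsSorted σ}) :
    (gridProd (fun a b => sortedBounce n (g a) (h b)) σ : Fin n ≃ Fin d ⊕ Fin m) =
      gridProd (fun a b => bounce (SimpleGraph.pathGraph n) (Sum.inl (g a)) (Sum.inr (h b))) σ :=
  coe_prod_map (fun _ => coe_prod_map (fun _ _ => rfl) _) _ σ

theorem coe_gridProd_sortedBounce_pow (g : Fin d → Fin d) (h : Fin m → Fin m) (t : ℕ)
    (σ : {σ : Fin n ≃ Fin d ⊕ Fin m // IsSorted σ}) :
    (((gridProd fun a b => sortedBounce n (g a) (h b)) ^ t) σ : Fin n ≃ Fin d ⊕ Fin m) =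
      ((gridProd fun a b => bounce (SimpleGraph.pathGraph n) (Sum.inl (g a))
        (Sum.inr (h b))) ^ t) σ := by
  induction t with
  | zero => rfl
  | succ t ih =>
    rw [pow_succ', pow_succ', Equiv.Perm.mul_apply, Equiv.Perm.mul_apply, ← ih]
    exact coe_gridProd_sortedBounce _ _ _

theorem card_fixedPoints_of_isConj {α : Type*} {f g : Equiv.Perm α} (h : IsConj f g) :
    Nat.card (Function.fixedPoints f) = Nat.card (Function.fixedPoints g) := by
  obtain ⟨c, hc⟩ := isConj_iff.mp h
  refine Nat.card_congr (c.subtypeEquiv fun x => ?_)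
  rw [← hc]
  simp [Function.fixedPoints, Function.IsFixedPt]

/-- The fixed points of the powers of the product of all bounces are equidistributed over the
ways to order the labels of each chain along the path. -/
theorem card_fixedPoints_gridProd_bounce (n d m t : ℕ) :
    Nat.card (Function.fixedPoints ((gridProd fun (a : Fin d) (b : Fin m) =>
      bounce (SimpleGraph.pathGraph n) (Sum.inl a) (Sum.inr b)) ^ t)) =
      d.factorial * m.factorial * Nat.card (Function.fixedPoints
        ((gridProd fun (a : Fin d) (b : Fin m) => sortedBounce n a b) ^ t)) := by
  let E := Equiv.ofBijective _ (bijective_relabel_sorted n d m)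
  let Φ (g : Equiv.Perm (Fin d) × Equiv.Perm (Fin m)) :=
    gridProd fun (a : Fin d) (b : Fin m) => sortedBounce n (g.1⁻¹ a) (g.2⁻¹ b)
  have hsemi : ∀ g : Equiv.Perm (Fin d) × Equiv.Perm (Fin m),
      SemiconjBy (relabel (Fin n) (Equiv.sumCongr g.1 g.2))
        (gridProd fun (a : Fin d) (b : Fin m) => bounce (SimpleGraph.pathGraph n)
          (Sum.inl (g.1⁻¹ a)) (Sum.inr (g.2⁻¹ b)))
        (gridProd fun (a : Fin d) (b : Fin m) => bounce (SimpleGraph.pathGraph n)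
          (Sum.inl a) (Sum.inr b)) := by
    intro g
    refine semiconjBy_prod_map _ fun a _ => semiconjBy_prod_map _ fun b _ => ?_
    have := relabel_mul_bounce (SimpleGraph.pathGraph n) (Equiv.sumCongr g.1 g.2)
      (Sum.inl (g.1⁻¹ a)) (Sum.inr (g.2⁻¹ b))
    simpa [SemiconjBy] using this
  have h1 : ∀ x : (Equiv.Perm (Fin d) × Equiv.Perm (Fin m)) ×
      {σ : Fin n ≃ Fin d ⊕ Fin m // IsSorted σ}, x.2 ∈ Function.fixedPoints (Φ x.1 ^ t) ↔
      E x ∈ Function.fixedPoints ((gridProd fun (a : Fin d) (b : Fin m) =>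
        bounce (SimpleGraph.pathGraph n) (Sum.inl a) (Sum.inr b)) ^ t) := by
    rintro ⟨g, σ⟩
    have h2 := congrArg (fun f => f σ.1) ((hsemi g).pow_right t).eq
    simp only [Equiv.Perm.mul_apply] at h2
    simp only [Function.mem_fixedPoints, Function.IsFixedPt]
    change _ ↔ _ = _
    rw [show E (g, σ) = relabel (Fin n) (Equiv.sumCongr g.1 g.2) σ.1 from rfl, ← h2,
      (relabel (Fin n) (Equiv.sumCongr g.1 g.2)).injective.eq_iff,
      ← coe_gridProd_sortedBounce_pow, Subtype.ext_iff]
  rw [← Nat.card_congr (E.subtypeEquiv h1),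
    Nat.card_congr (Equiv.subtypeProdEquivSigmaSubtype
      fun g σ => σ ∈ Function.fixedPoints (Φ g ^ t)), Nat.card_sigma]
  have h3 : ∀ g, Nat.card {σ // σ ∈ Function.fixedPoints (Φ g ^ t)} =
      Nat.card (Function.fixedPoints
        ((gridProd fun (a : Fin d) (b : Fin m) => sortedBounce n a b) ^ t)) := by
    intro g
    refine card_fixedPoints_of_isConj (IsConj.pow t ?_)
    exact isConj_gridProd_perm (fun _ _ _ _ => commute_sortedBounce)
      (fun _ _ b hab => commute_sortedBounce_row b hab)
      (fun a _ _ hab => commute_sortedBounce_column a hab) _ _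
  simp only [h3, Finset.sum_const, Finset.card_univ, Fintype.card_prod, Fintype.card_perm,
    Fintype.card_fin, smul_eq_mul]

end Path

/-! ### Rotation of sorted labelings -/

/-- Induction along a product of permutations, which act from the last one to the first one. -/
theorem prod_map_finRange_induction {S : Type*} {d : ℕ} (f : Fin d → Equiv.Perm S)
    (Q : ℕ → S → Prop) (h : ∀ (a : Fin d) σ, Q (a.val + 1) σ → Q a.val (f a σ)) {σ : S}
    (hσ : Q d σ) : Q 0 (((List.finRange d).map f).prod σ) := by
  induction d generalizing Q with
  | zero => simpa using hσ
  | succ d ih =>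
    rw [List.finRange_succ, List.map_cons, List.prod_cons, List.map_map, Equiv.Perm.mul_apply]
    exact h 0 _ (ih (f ∘ Fin.succ) (fun k => Q (k + 1)) (fun a σ hQ => h a.succ σ hQ) hσ)

section Word

variable {n d m : ℕ}

/-- The number of labels `inl a` among the first `i` vertices. -/
def leftCount (σ : Fin n ≃ Fin d ⊕ Fin m) (i : ℕ) : ℕ :=
  (Finset.univ.filter fun a : Fin d => (σ.symm (Sum.inl a)).val < i).card

theorem leftCount_zero (σ : Fin n ≃ Fin d ⊕ Fin m) : leftCount σ 0 = 0 := by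
  simp [leftCount]

theorem leftCount_self (σ : Fin n ≃ Fin d ⊕ Fin m) : leftCount σ n = d := by
  simp [leftCount]

theorem leftCount_succ_of_inl {σ : Fin n ≃ Fin d ⊕ Fin m} {v : Fin n} {a : Fin d}
    (h : σ v = Sum.inl a) : leftCount σ (v.val + 1) = leftCount σ v.val + 1 := by
  have hv : σ.symm (Sum.inl a) = v := by rw [← h, Equiv.symm_apply_apply]
  rw [leftCount, leftCount, ← Finset.card_insert_of_notMem (a := a)]
  · congr 1
    ext a'
    simp only [Finset.mem_filter, Finset.mem_univ, true_and, Finset.mem_insert]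
    rw [Nat.lt_succ_iff_lt_or_eq, or_comm]
    refine or_congr ⟨fun h' => ?_, fun h' => by rw [h', hv]⟩ Iff.rfl
    exact Sum.inl_injective (σ.symm.injective (by rw [hv]; exact Fin.ext h'))
  · simp [hv]

theorem leftCount_succ_of_inr {σ : Fin n ≃ Fin d ⊕ Fin m} {v : Fin n} {b : Fin m}
    (h : σ v = Sum.inr b) : leftCount σ (v.val + 1) = leftCount σ v.val := by
  rw [leftCount, leftCount]
  congr 1
  ext a'
  simp only [Finset.mem_filter, Finset.mem_univ, true_and]
  rw [Nat.lt_succ_iff_lt_or_eq, or_iff_left]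
  intro h'
  have : σ.symm (Sum.inl a') = v := Fin.ext h'
  rw [Equiv.symm_apply_eq, h] at this
  simp at this

theorem leftCount_succ (σ : Fin n ≃ Fin d ⊕ Fin m) (v : Fin n) :
    leftCount σ (v.val + 1) = leftCount σ v.val + if (σ v).isLeft then 1 else 0 := by
  cases h : σ v with
  | inl a => simp [leftCount_succ_of_inl h]
  | inr b => simp [leftCount_succ_of_inr h]

theorem leftCount_step (σ : Fin n ≃ Fin d ⊕ Fin m) (i : ℕ) :
    leftCount σ i ≤ leftCount σ (i + 1) ∧ leftCount σ (i + 1) ≤ leftCount σ i + 1 := by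
  by_cases hi : i < n
  · have := leftCount_succ σ ⟨i, hi⟩
    simp only at this
    rw [this]
    split_ifs <;> omega
  · have h : ∀ j, n ≤ j → leftCount σ j = d := by
      intro j hj
      have : ∀ a, (σ.symm (Sum.inl a)).val < j := fun a => (σ.symm (Sum.inl a)).isLt.trans_le hj
      simp [leftCount, this]
    rw [h i (by omega), h (i + 1) (by omega)]
    omega

theorem IsSorted.leftCount_eq {σ : Fin n ≃ Fin d ⊕ Fin m} (hσ : IsSorted σ) {v : Fin n} {a : Fin d}
    (h : σ v = Sum.inl a) : leftCount σ v.val = a.val := by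
  have hv : σ.symm (Sum.inl a) = v := by rw [← h, Equiv.symm_apply_apply]
  rw [leftCount, ← Fin.card_Iio a]
  congr 1
  ext a'
  simp only [Finset.mem_filter, Finset.mem_univ, true_and, Finset.mem_Iio]
  rw [← hσ.1.lt_iff_lt, ← hv, Fin.lt_def]

/-- The number of labels `inr b` among the first `i` vertices. -/
def rightCount (σ : Fin n ≃ Fin d ⊕ Fin m) (i : ℕ) : ℕ :=
  leftCount (σ.trans (Equiv.sumComm _ _)) i

theorem leftCount_add_rightCount (σ : Fin n ≃ Fin d ⊕ Fin m) (i : ℕ) (hi : i ≤ n) :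
    leftCount σ i + rightCount σ i = i := by
  induction i with
  | zero => simp [rightCount, leftCount_zero]
  | succ i ih =>
    have h1 := leftCount_succ σ ⟨i, hi⟩
    have h2 := leftCount_succ (σ.trans (Equiv.sumComm _ _)) ⟨i, hi⟩
    specialize ih (by omega)
    simp only [rightCount] at ih h1 h2 ⊢
    rw [h1, h2]
    cases h : σ ⟨i, hi⟩ <;> simp [h] <;> omega

theorem IsSorted.leftCount_add_eq {σ : Fin n ≃ Fin d ⊕ Fin m} (hσ : IsSorted σ) {v : Fin n}
    {b : Fin m} (h : σ v = Sum.inr b) : leftCount σ v.val + b.val = v.val := by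
  have h1 := leftCount_add_rightCount σ v.val v.isLt.le
  have h2 : IsSorted (σ.trans (Equiv.sumComm (Fin d) (Fin m))) := ⟨hσ.2, hσ.1⟩
  have h3 := h2.leftCount_eq (v := v) (a := b) (by simp [h])
  rw [rightCount, h3] at h1
  exact h1

/-- The counts form the lattice path of a sorted labeling. The bounce of `inl a` and `inr b` flips
its corner in the box `(a, b)`, if there is one. -/
theorem IsSorted.leftCount_bounce {σ : Fin n ≃ Fin d ⊕ Fin m} (hσ : IsSorted σ) (a : Fin d)
    (b : Fin m) (i : ℕ) :
    leftCount (bounce (SimpleGraph.pathGraph n) (Sum.inl a) (Sum.inr b) σ) i =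
      if i = a.val + b.val + 1 ∧ leftCount σ (a.val + b.val) = a.val ∧
        leftCount σ (a.val + b.val + 1 + 1) = a.val + 1 then 2 * a.val + 1 - leftCount σ i
      else leftCount σ i := by
  have hσ' := (isSorted_bounce_iff σ a b).mpr hσ
  set σ' := bounce (SimpleGraph.pathGraph n) (Sum.inl a) (Sum.inr b) σ with hdef
  by_cases hadj : (SimpleGraph.pathGraph n).Adj (σ.symm (Sum.inl a)) (σ.symm (Sum.inr b))
  · rw [bounce_apply_of_adj _ hadj] at hdef
    rw [SimpleGraph.pathGraph_adj] at hadj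
    obtain ⟨v, hv⟩ : ∃ v, σ.symm (Sum.inl a) = v := ⟨_, rfl⟩
    obtain ⟨w, hw⟩ : ∃ w, σ.symm (Sum.inr b) = w := ⟨_, rfl⟩
    rw [hv, hw] at hadj
    have hv1 : σ v = Sum.inl a := by rw [← hv, Equiv.apply_symm_apply]
    have hw1 : σ w = Sum.inr b := by rw [← hw, Equiv.apply_symm_apply]
    have hw2 : σ' w = Sum.inl a := by simp [hdef, hw1]
    have e1 := hσ.leftCount_eq hv1
    have e2 := hσ.leftCount_add_eq hw1
    have e3 := leftCount_succ_of_inl hv1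
    have e4 := leftCount_succ_of_inr hw1
    have e5 := hσ'.leftCount_eq hw2
    have e6 := leftCount_succ_of_inl hw2
    have hother : i ≠ a.val + b.val + 1 → (v.val < i ↔ w.val < i) →
        leftCount σ' i = leftCount σ i := by
      intro _ hvw
      rw [leftCount, leftCount]
      congr 1
      ext a'
      simp only [Finset.mem_filter, Finset.mem_univ, true_and]
      by_cases haa : a' = a
      · subst haa
        have : σ'.symm (Sum.inl a') = w := by rw [← hw2, Equiv.symm_apply_apply]
        rw [this, hv]
        exact hvw.symm
      · have : σ'.symm (Sum.inl a') = σ.symm (Sum.inl a') := by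
          rw [hdef, Equiv.symm_trans_apply, Equiv.symm_swap,
            Equiv.swap_apply_of_ne_of_ne (by simpa using haa) (by simp)]
        rw [this]
    rcases hadj with hadj | hadj
    · rw [← hadj] at e2 e4 e5
      have hva : v.val = a.val + b.val := by omega
      by_cases hi : i = a.val + b.val + 1
      · rw [if_pos ⟨hi, by rw [← hva]; exact e1, by rw [← hva]; omega⟩, hi, ← hva]
        omega
      · rw [if_neg fun h => hi h.1]
        exact hother hi (by omega)
    · rw [← hadj] at e1 e3
      have hwa : w.val = a.val + b.val := by omega
      by_cases hi : i = a.val + b.val + 1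
      · rw [if_pos ⟨hi, by rw [← hwa]; omega, by rw [← hwa]; omega⟩, hi, ← hwa]
        omega
      · rw [if_neg fun h => hi h.1]
        exact hother hi (by omega)
  · rw [hdef, bounce_apply_of_not_adj _ hadj, if_neg]
    rintro ⟨-, h1, h2⟩
    have hn : n = d + m := by
      have := Fintype.card_congr σ
      simpa using this
    have hlt1 : a.val + b.val < n := by omega
    have hlt2 : a.val + b.val + 1 < n := by omega
    apply hadj
    rw [SimpleGraph.pathGraph_adj]
    cases hv : σ ⟨a.val + b.val, hlt1⟩ with
    | inl a1 =>
      have e1 := hσ.leftCount_eq hv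
      have e2 := leftCount_succ_of_inl hv
      obtain rfl : a1 = a := Fin.ext (by rw [← e1]; exact h1)
      cases hw : σ ⟨a1.val + b.val + 1, hlt2⟩ with
      | inl a2 =>
        have e3 := leftCount_succ_of_inl hw
        simp only at e1 e2 e3
        omega
      | inr b1 =>
        have e3 := hσ.leftCount_add_eq hw
        simp only at e1 e2 e3
        obtain rfl : b1 = b := Fin.ext (by omega)
        left
        rw [← hv, ← hw, Equiv.symm_apply_apply, Equiv.symm_apply_apply]
    | inr b1 =>
      have e1 := hσ.leftCount_add_eq hv
      have e2 := leftCount_succ_of_inr hv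
      simp only at e1 e2
      obtain rfl : b1 = b := Fin.ext (by omega)
      cases hw : σ ⟨a.val + b1.val + 1, hlt2⟩ with
      | inl a2 =>
        have e3 := hσ.leftCount_eq hw
        simp only at e3
        obtain rfl : a2 = a := Fin.ext (by omega)
        right
        rw [← hv, ← hw, Equiv.symm_apply_apply, Equiv.symm_apply_apply]
      | inr b2 =>
        have e3 := leftCount_succ_of_inr hw
        simp only at e3
        omega

/-- The arithmetic of one step in the proof of `leftCount_gridProd_sortedBounce`. The numbers
`N, N0, N1, N2` are consecutive counts before, and `K0, K1, K2` the last three of them after the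
boxes that follow `(a, b)` have been processed. -/
theorem corner_flip_eq {n d a b e N N0 N1 N2 K0 K1 K2 : ℕ} (hn : a + b + 1 ≤ n - 1) (he : e ≤ 1)
    (s0 : N0 ≤ N1 ∧ N1 ≤ N0 + 1) (s1 : N1 ≤ N2 ∧ N2 ≤ N1 + 1) (hzero : a + b ≠ 0 ∨ N0 = 0)
    (hend : a + b + 1 + 1 ≠ n ∨ N1 + e = d)
    (k0 : K0 = if 1 ≤ a + b then
      (if a + 1 < N0 + e ∨ (a + 1 = N0 + e ∧ b + 1 + a + 1 ≤ a + b) then N + e else N0) else 0)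
    (k1 : K1 = if a + 1 < N1 + e ∨ (a + 1 = N1 + e ∧ b + 1 + a + 1 ≤ a + b + 1) then N0 + e
      else N1)
    (k2 : K2 = if a + b + 1 + 1 ≤ n - 1 then
      (if a + 1 < N2 + e ∨ (a + 1 = N2 + e ∧ b + 1 + a + 1 ≤ a + b + 1 + 1) then N1 + e
        else N2) else d) :
    (if K0 = a ∧ K2 = a + 1 then 2 * a + 1 - K1 else K1) =
      if a + 1 < N1 + e ∨ (a + 1 = N1 + e ∧ b + a + 1 ≤ a + b + 1) then N0 + e else N1 := by
  split_ifs at k0 k1 k2 ⊢ <;> omega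

/-- After all bounces, the counts are shifted by one step around the cycle. The last summand tells
whether the last vertex carries a label `inl a`. -/
theorem leftCount_gridProd_sortedBounce (σ : {σ : Fin n ≃ Fin d ⊕ Fin m // IsSorted σ}) (i : ℕ)
    (hi : 1 ≤ i) (hin : i ≤ n - 1) :
    leftCount (gridProd (fun a b => sortedBounce n a b) σ).1 i =
      leftCount σ.1 (i - 1) + (d - leftCount σ.1 (n - 1)) := by
  have hn : n = d + m := by
    have := Fintype.card_congr σ.1
    simpa using this
  set N := leftCount σ.1 with hN
  have hstep := leftCount_step σ.1
  rw [← hN] at hstep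
  have hdist : ∀ i j, N i ≤ N (i + j) ∧ N (i + j) ≤ N i + j := by
    intro i j
    induction j with
    | zero => simp
    | succ j ih =>
      have := hstep (i + j)
      rw [← add_assoc]
      omega
  have hN0 : N 0 = 0 := leftCount_zero _
  have hNn : N n = d := leftCount_self _
  obtain ⟨e, he⟩ : ∃ e, e = d - N (n - 1) := ⟨_, rfl⟩
  have hlast := hstep (n - 1)
  rw [show n - 1 + 1 = n by omega, hNn] at hlast
  rw [← he]
  -- The boxes are processed in decreasing lexicographic order. The `i`-th count changes to its
  -- final value in the box `(N i + e - 1, i - N i - e)`. So `Inv a b` describes the labeling `τ`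
  -- after the boxes from `(a, b)` on have been processed.
  let Inv : ℕ → ℕ → {σ : Fin n ≃ Fin d ⊕ Fin m // IsSorted σ} → Prop := fun a b τ =>
    ∀ i, 1 ≤ i → i ≤ n - 1 → leftCount τ.1 i =
      if a + 1 < N i + e ∨ (a + 1 = N i + e ∧ b + a + 1 ≤ i) then N (i - 1) + e else N i
  have hbox : ∀ (a : Fin d) (b : Fin m) τ, Inv a (b.val + 1) τ → Inv a b (sortedBounce n a b τ) := by
    intro a b τ hτ i hi hin
    rw [coe_sortedBounce, τ.2.leftCount_bounce]
    have ha := a.isLt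
    have hb := b.isLt
    by_cases hi0 : i = a.val + b.val + 1
    · subst hi0
      have k1 := hτ _ hi hin
      have k0 : leftCount τ.1 (a.val + b.val) = if 1 ≤ a.val + b.val then
          (if a.val + 1 < N (a.val + b.val) + e ∨ (a.val + 1 = N (a.val + b.val) + e ∧
            b.val + 1 + a.val + 1 ≤ a.val + b.val) then N (a.val + b.val - 1) + e
            else N (a.val + b.val)) else 0 := by
        split_ifs with h1 h2
        · rw [hτ _ h1 (by omega), if_pos h2]
        · rw [hτ _ h1 (by omega), if_neg h2]
        · rw [show a.val + b.val = 0 by omega, leftCount_zero]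
      have k2 : leftCount τ.1 (a.val + b.val + 1 + 1) = if a.val + b.val + 1 + 1 ≤ n - 1 then
          (if a.val + 1 < N (a.val + b.val + 1 + 1) + e ∨ (a.val + 1 = N (a.val + b.val + 1 + 1) + e ∧
            b.val + 1 + a.val + 1 ≤ a.val + b.val + 1 + 1) then N (a.val + b.val + 1) + e
            else N (a.val + b.val + 1 + 1)) else d := by
        split_ifs with h1 h2
        · rw [hτ _ (by omega) h1, if_pos h2]
          rfl
        · rw [hτ _ (by omega) h1, if_neg h2]
        · rw [show a.val + b.val + 1 + 1 = n by omega, leftCount_self]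
      have hzero : a.val + b.val ≠ 0 ∨ N (a.val + b.val) = 0 :=
        (em _).symm.imp_right fun h => by rw [h, hN0]
      have hend : a.val + b.val + 1 + 1 ≠ n ∨ N (a.val + b.val + 1) + e = d :=
        (em _).symm.imp_right fun h => by
          rw [show a.val + b.val + 1 = n - 1 by omega]
          omega
      simp only [Nat.add_sub_cancel, true_and] at k1 ⊢
      exact corner_flip_eq hin (by omega) (hstep _) (hstep _) hzero hend k0 k1 k2
    · rw [if_neg fun h => hi0 h.1, hτ i hi hin]
      split_ifs <;> omega
  -- passing from one column to the next: the two conditions differ only where both values agree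
  have hrow : ∀ (a : ℕ) τ, Inv (a + 1) 0 τ → Inv a m τ := by
    intro a τ hτ i hi hin
    rw [hτ i hi hin]
    have h1 := hdist 0 i
    have h2 := hdist i (n - 1 - i)
    have h3 := hstep (i - 1)
    have h4 := hdist 0 (i - 1)
    rw [show i - 1 + 1 = i by omega] at h3
    rw [show i + (n - 1 - i) = n - 1 by omega] at h2
    rw [hN0, zero_add] at h1 h4
    have h5 := hdist (i - 1) (n - 1 - (i - 1))
    rw [show i - 1 + (n - 1 - (i - 1)) = n - 1 by omega] at h5
    split_ifs <;> omega
  have hstart : Inv d 0 σ := by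
    intro i hi hin
    have h2 := hdist i (n - 1 - i)
    rw [show i + (n - 1 - i) = n - 1 by omega] at h2
    rw [if_neg (by omega)]
  have key : Inv 0 0 (gridProd (fun a b => sortedBounce n a b) σ) := by
    refine prod_map_finRange_induction _ (fun a τ => Inv a 0 τ) (fun a τ hτ => ?_) hstart
    exact prod_map_finRange_induction _ (fun b τ => Inv a b τ) (fun b τ hτ => hbox a b τ hτ)
      (hrow a τ hτ)
  rw [key i hi hin]
  have h3 := hstep (i - 1)
  rw [show i - 1 + 1 = i by omega] at h3
  split_ifs <;> omega

theorem isLeft_iff_leftCount (σ : Fin n ≃ Fin d ⊕ Fin m) (v : Fin n) :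
    (σ v).isLeft ↔ leftCount σ (v.val + 1) = leftCount σ v.val + 1 := by
  rw [leftCount_succ]
  split_ifs with h <;> simp [h]

/-- The product of all bounces rotates the positions of the labels `inl a` in a sorted
labeling. -/
theorem isLeft_gridProd_sortedBounce (σ : {σ : Fin n ≃ Fin d ⊕ Fin m // IsSorted σ}) :
    (∀ i (h : i + 1 < n), ((gridProd (fun a b => sortedBounce n a b) σ).1 ⟨i + 1, h⟩).isLeft ↔
      (σ.1 ⟨i, by omega⟩).isLeft) ∧
    ∀ h : 1 < n, ((gridProd (fun a b => sortedBounce n a b) σ).1 ⟨0, by omega⟩).isLeft ↔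
      (σ.1 ⟨n - 1, by omega⟩).isLeft := by
  have key := leftCount_gridProd_sortedBounce σ
  set τ := (gridProd (fun a b => sortedBounce n a b) σ).1
  have hstep := leftCount_step σ.1 (n - 1)
  refine ⟨fun i h => ?_, fun h => ?_⟩
  · rw [isLeft_iff_leftCount, isLeft_iff_leftCount]
    rw [show n - 1 + 1 = n by omega, leftCount_self] at hstep
    have k1 := key (i + 1) (by omega) (by omega)
    rw [Nat.add_sub_cancel] at k1
    simp only
    rw [k1]
    by_cases hi : i + 2 ≤ n - 1
    · have k2 := key (i + 2) (by omega) hi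
      rw [show i + 2 - 1 = i + 1 by omega] at k2
      rw [k2]
      omega
    · have hi' : i + 1 = n - 1 := by omega
      rw [show i + 1 + 1 = n by omega, leftCount_self, hi']
      omega
  · rw [isLeft_iff_leftCount, isLeft_iff_leftCount]
    rw [show n - 1 + 1 = n by omega, leftCount_self] at hstep
    simp only
    rw [show n - 1 + 1 = n by omega, leftCount_self, key 1 le_rfl (by omega), Nat.sub_self,
      leftCount_zero, leftCount_zero]
    omega

end Word

/-! ### Subsets invariant under translation -/

section Translation

theorem ZMod.card_filter_castHom_mem {n g : ℕ} [NeZero n] [NeZero g] (h : g ∣ n)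
    (T : Finset (ZMod g)) :
    (Finset.univ.filter fun x : ZMod n => ZMod.castHom h (ZMod g) x ∈ T).card =
      n / g * T.card := by
  classical
  let φ : ZMod n →+ ZMod g := (ZMod.castHom h (ZMod g)).toAddMonoidHom
  have hsurj : Function.Surjective φ := ZMod.castHom_surjective h
  have hfib : ∀ y, (Finset.univ.filter fun x : ZMod n => φ x = y).card =
      (Finset.univ.filter fun x : ZMod n => φ x = 0).card := fun y =>
    AddMonoidHom.card_fiber_eq_of_mem_range φ (hsurj y) (hsurj 0)
  have hcount : ∀ T : Finset (ZMod g), (Finset.univ.filter fun x : ZMod n => φ x ∈ T).card =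
      T.card * (Finset.univ.filter fun x : ZMod n => φ x = 0).card := by
    intro T
    rw [Finset.card_eq_sum_card_fiberwise (t := T) (f := φ) (by
      intro x hx
      simpa using hx)]
    rw [← smul_eq_mul, ← Finset.sum_const]
    refine Finset.sum_congr rfl fun y hy => ?_
    rw [← hfib y, Finset.filter_filter]
    congr 1
    ext x
    simp only [Finset.mem_filter, Finset.mem_univ, true_and]
    exact ⟨fun hx => hx.2, fun hx => ⟨by rwa [hx], hx⟩⟩
  have hall := hcount Finset.univ
  simp only [Finset.mem_univ, Finset.filter_true, Finset.card_univ, ZMod.card] at hall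
  have hdiv : n / g = (Finset.univ.filter fun x : ZMod n => φ x = 0).card :=
    Nat.div_eq_of_eq_mul_right (NeZero.pos g) hall
  rw [hdiv, mul_comm]
  exact hcount T

theorem ZMod.add_mul_mem_iff {n : ℕ} {S : Finset (ZMod n)} {t : ZMod n}
    (hS : ∀ x, x + t ∈ S ↔ x ∈ S) (k : ℕ) (x : ZMod n) : x + k * t ∈ S ↔ x ∈ S := by
  induction k with
  | zero => simp
  | succ k ih => rw [Nat.cast_succ, add_mul, one_mul, ← add_assoc, hS, ih]

/-- A set that is invariant under translation by `t` is a union of fibres of the reduction modulo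
`gcd n t`. -/
theorem ZMod.mem_iff_of_castHom_eq {n t : ℕ} [NeZero n] {S : Finset (ZMod n)}
    (hS : ∀ x, x + (t : ZMod n) ∈ S ↔ x ∈ S) {x y : ZMod n}
    (hxy : ZMod.castHom (Nat.gcd_dvd_left n t) (ZMod (n.gcd t)) x =
      ZMod.castHom (Nat.gcd_dvd_left n t) (ZMod (n.gcd t)) y) : x ∈ S ↔ y ∈ S := by
  have h1 : ((y - x).val : ZMod (n.gcd t)) = 0 := by
    rw [← map_natCast (ZMod.castHom (Nat.gcd_dvd_left n t) (ZMod (n.gcd t))),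
      ZMod.natCast_zmod_val, map_sub, hxy, sub_self]
  obtain ⟨k, hk⟩ := (ZMod.natCast_eq_zero_iff _ _).mp h1
  have h2 : ((n.gcd t : ℕ) : ZMod n) = (Nat.gcdB n t : ZMod n) * t := by
    have h3 := congrArg (fun z : ℤ => (z : ZMod n)) (Nat.gcd_eq_gcd_ab n t)
    push_cast at h3
    rw [h3]
    simp [mul_comm]
  have h4 : y - x = ((((k : ZMod n) * (Nat.gcdB n t : ZMod n)).val : ℕ) : ZMod n) * t := by
    rw [ZMod.natCast_zmod_val, mul_assoc, ← h2, ← ZMod.natCast_zmod_val (y - x), hk]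
    push_cast
    ring
  rw [← ZMod.add_mul_mem_iff hS (((k : ZMod n) * (Nat.gcdB n t : ZMod n)).val) x, ← h4,
    add_sub_cancel]

/-- The number of subsets of `ℤ/nℤ` of given size that are invariant under translation by `t`: they
are the unions of cosets of the subgroup generated by `t`, which has order `n / gcd n t`. -/
theorem ZMod.card_translation_invariant {n : ℕ} [NeZero n] (t d' : ℕ) :
    Nat.card {S : Finset (ZMod n) // S.card = n / n.gcd t * d' ∧
      ∀ x, x + (t : ZMod n) ∈ S ↔ x ∈ S} = (n.gcd t).choose d' := by
  classical
  have hg : 0 < n.gcd t := Nat.gcd_pos_of_pos_left _ (NeZero.pos n)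
  have : NeZero (n.gcd t) := ⟨hg.ne'⟩
  have hs : 0 < n / n.gcd t := Nat.div_pos (Nat.le_of_dvd (NeZero.pos n) (Nat.gcd_dvd_left n t)) hg
  let φ := ZMod.castHom (Nat.gcd_dvd_left n t) (ZMod (n.gcd t))
  have hφ : Function.Surjective φ := ZMod.castHom_surjective _
  have hφt : φ t = 0 := by
    rw [map_natCast]
    exact (ZMod.natCast_eq_zero_iff _ _).mpr (Nat.gcd_dvd_right n t)
  have hcard : ((n.gcd t).choose d') = Nat.card {T : Finset (ZMod (n.gcd t)) // T.card = d'} := by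
    rw [Nat.card_eq_fintype_card, Fintype.card_finset_len, ZMod.card]
  rw [hcard]
  symm
  refine Nat.card_congr (Equiv.ofBijective
    (fun T => ⟨Finset.univ.filter fun x => φ x ∈ T.1, ?_, fun x => ?_⟩) ⟨?_, ?_⟩)
  · rw [ZMod.card_filter_castHom_mem, T.2]
  · simp [hφt]
  · rintro ⟨T, hT⟩ ⟨T', hT'⟩ h
    refine Subtype.ext (Finset.ext fun y => ?_)
    obtain ⟨x, rfl⟩ := hφ y
    have := congrArg (fun S => x ∈ S.1) h
    simpa using this
  · rintro ⟨S, hS, hinv⟩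
    have hpre : (Finset.univ.filter fun x => φ x ∈ S.image φ) = S := by
      ext x
      simp only [Finset.mem_filter, Finset.mem_univ, true_and, Finset.mem_image]
      refine ⟨?_, fun hx => ⟨x, hx, rfl⟩⟩
      rintro ⟨y, hy, hyx⟩
      exact (ZMod.mem_iff_of_castHom_eq hinv hyx).mp hy
    refine ⟨⟨S.image φ, ?_⟩, Subtype.ext hpre⟩
    refine Nat.eq_of_mul_eq_mul_left hs ?_
    rw [← hS, ← ZMod.card_filter_castHom_mem (Nat.gcd_dvd_left n t), hpre]

end Translation

section WordSet

variable {n d m : ℕ}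

/-- The positions of the labels `inl a`, as elements of `ℤ/nℤ`. -/
def wordSet (σ : Fin n ≃ Fin d ⊕ Fin m) : Finset (ZMod n) :=
  Finset.univ.image fun a : Fin d => ((σ.symm (Sum.inl a)).val : ZMod n)

theorem mem_wordSet_iff [NeZero n] (σ : Fin n ≃ Fin d ⊕ Fin m) (x : ZMod n) :
    x ∈ wordSet σ ↔ (σ ⟨x.val, ZMod.val_lt x⟩).isLeft := by
  rw [wordSet, Finset.mem_image, Sum.isLeft_iff]
  constructor
  · rintro ⟨a, -, rfl⟩
    refine ⟨a, ?_⟩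
    rw [← Equiv.eq_symm_apply]
    exact Fin.ext (ZMod.val_natCast_of_lt (Fin.isLt _))
  · rintro ⟨a, ha⟩
    refine ⟨a, Finset.mem_univ _, ?_⟩
    rw [← ha, Equiv.symm_apply_apply]
    exact ZMod.natCast_zmod_val x

theorem card_wordSet (σ : Fin n ≃ Fin d ⊕ Fin m) : (wordSet σ).card = d := by
  rw [wordSet, Finset.card_image_of_injective, Finset.card_univ, Fintype.card_fin]
  intro a a' h
  have h1 := congrArg ZMod.val h
  simp only at h1
  rw [ZMod.val_natCast_of_lt (Fin.isLt _), ZMod.val_natCast_of_lt (Fin.isLt _)] at h1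
  exact Sum.inl_injective (σ.symm.injective (Fin.ext h1))

theorem add_one_mem_wordSet [Fact (1 < n)] [NeZero n]
    (σ : {σ : Fin n ≃ Fin d ⊕ Fin m // IsSorted σ}) (x : ZMod n) :
    x + 1 ∈ wordSet (gridProd (fun a b => sortedBounce n a b) σ).1 ↔ x ∈ wordSet σ.1 := by
  have h1n : 1 < n := Fact.out
  obtain ⟨h1, h2⟩ := isLeft_gridProd_sortedBounce σ
  rw [mem_wordSet_iff, mem_wordSet_iff]
  have hx := ZMod.val_add_one_eq x
  split_ifs at hx with h
  · have e1 : (⟨(x + 1).val, ZMod.val_lt _⟩ : Fin n) = ⟨0, by omega⟩ := Fin.ext hx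
    have e2 : (⟨x.val, ZMod.val_lt _⟩ : Fin n) = ⟨n - 1, by omega⟩ :=
      Fin.ext (by simp only; omega)
    rw [e1, e2]
    exact h2 h1n
  · have hlt := ZMod.val_lt x
    have e1 : (⟨(x + 1).val, ZMod.val_lt _⟩ : Fin n) = ⟨x.val + 1, by omega⟩ := Fin.ext hx
    rw [e1]
    exact h1 x.val (by omega)

theorem add_mem_wordSet_pow [Fact (1 < n)] [NeZero n] (t : ℕ)
    (σ : {σ : Fin n ≃ Fin d ⊕ Fin m // IsSorted σ}) (x : ZMod n) :
    x + (t : ZMod n) ∈ wordSet ((gridProd (fun a b => sortedBounce n a b) ^ t) σ).1 ↔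
      x ∈ wordSet σ.1 := by
  induction t with
  | zero => simp
  | succ t ih =>
    rw [pow_succ', Equiv.Perm.mul_apply, Nat.cast_succ, ← add_assoc, add_one_mem_wordSet, ih]

/-- A sorted labeling is determined by the positions of the labels `inl a`. -/
theorem wordSet_injective [NeZero n] {σ τ : Fin n ≃ Fin d ⊕ Fin m} (hσ : IsSorted σ)
    (hτ : IsSorted τ) (h : wordSet σ = wordSet τ) : σ = τ := by
  have hleft : ∀ v : Fin n, (σ v).isLeft ↔ (τ v).isLeft := by
    intro v
    have h1 := mem_wordSet_iff σ (v.val : ZMod n)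
    have h2 := mem_wordSet_iff τ (v.val : ZMod n)
    have h3 : (⟨(v.val : ZMod n).val, ZMod.val_lt _⟩ : Fin n) = v :=
      Fin.ext (ZMod.val_natCast_of_lt v.isLt)
    rw [h3] at h1 h2
    rw [← h1, ← h2, h]
  have hcount : ∀ i ≤ n, leftCount σ i = leftCount τ i := by
    intro i
    induction i with
    | zero => intro _; rw [leftCount_zero, leftCount_zero]
    | succ i ih =>
      intro hi
      have h1 := leftCount_succ σ ⟨i, hi⟩
      have h2 := leftCount_succ τ ⟨i, hi⟩
      simp only [hleft] at h1
      simp only at h2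
      rw [h1, h2, ih (by omega)]
  ext1 v
  have hv := hleft v
  have hc := hcount v.val v.isLt.le
  cases h1 : σ v with
  | inl a =>
    cases h2 : τ v with
    | inl a' =>
      rw [hσ.leftCount_eq h1, hτ.leftCount_eq h2] at hc
      rw [Fin.ext hc]
    | inr b' => simp [h1, h2] at hv
  | inr b =>
    cases h2 : τ v with
    | inl a' => simp [h1, h2] at hv
    | inr b' =>
      have e1 := hσ.leftCount_add_eq h1
      have e2 := hτ.leftCount_add_eq h2
      rw [show b = b' from Fin.ext (by omega)]

theorem exists_isSorted_wordSet_eq [NeZero n] (hn : n = d + m) (S : Finset (ZMod n))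
    (hS : S.card = d) : ∃ σ : Fin n ≃ Fin d ⊕ Fin m, IsSorted σ ∧ wordSet σ = S := by
  classical
  let T : Finset (Fin n) := Finset.univ.filter fun v => (v.val : ZMod n) ∈ S
  have hT : T.card = d := by
    rw [← hS]
    refine Finset.card_bij (fun v _ => (v.val : ZMod n)) ?_ ?_ ?_
    · intro v hv
      simpa [T] using hv
    · intro v _ w _ h
      have h1 := congrArg ZMod.val h
      rw [ZMod.val_natCast_of_lt v.isLt, ZMod.val_natCast_of_lt w.isLt] at h1
      exact Fin.ext h1
    · intro x hx
      exact ⟨⟨x.val, ZMod.val_lt x⟩, by simpa [T] using hx, by simp⟩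
  have hTc : Tᶜ.card = m := by
    rw [Finset.card_compl, hT, Fintype.card_fin]
    omega
  refine ⟨(finSumEquivOfFinset hT hTc).symm, ⟨?_, ?_⟩, ?_⟩
  · intro a a' h
    simpa using h
  · intro b b' h
    simpa using h
  · refine Finset.eq_of_subset_of_card_le (fun x hx => ?_) (by rw [card_wordSet, hS])
    obtain ⟨a, -, rfl⟩ := Finset.mem_image.mp hx
    have : T.orderEmbOfFin hT a ∈ T := Finset.orderEmbOfFin_mem T hT a
    rw [Equiv.symm_symm, finSumEquivOfFinset_inl]
    exact (Finset.mem_filter.mp this).2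

/-- On sorted labelings, the product of all bounces is the rotation of subsets of `ℤ/nℤ`. -/
theorem card_fixedPoints_sortedBounce_pow [Fact (1 < n)] [NeZero n] (hn : n = d + m) (t : ℕ) :
    Nat.card (Function.fixedPoints
        ((gridProd fun (a : Fin d) (b : Fin m) => sortedBounce n a b) ^ t)) =
      Nat.card {S : Finset (ZMod n) // S.card = d ∧ ∀ x, x + (t : ZMod n) ∈ S ↔ x ∈ S} := by
  have hfix : ∀ σ : {σ : Fin n ≃ Fin d ⊕ Fin m // IsSorted σ},
      σ ∈ Function.fixedPoints ((gridProd fun (a : Fin d) (b : Fin m) =>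
        sortedBounce n a b) ^ t) ↔ ∀ x, x + (t : ZMod n) ∈ wordSet σ.1 ↔ x ∈ wordSet σ.1 := by
    intro σ
    have h := add_mem_wordSet_pow t σ
    rw [Function.mem_fixedPoints, Function.IsFixedPt]
    constructor
    · intro hσ x
      rw [← h x, hσ]
    · intro hx
      refine Subtype.ext (wordSet_injective (Subtype.prop _) σ.2 (Finset.ext fun x => ?_))
      rw [← sub_add_cancel x (t : ZMod n), h, hx]
  refine Nat.card_congr (Equiv.ofBijective (fun σ => ⟨wordSet σ.1.1, card_wordSet _,
    (hfix σ.1).mp σ.2⟩) ⟨?_, ?_⟩)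
  · rintro ⟨σ, _⟩ ⟨τ, _⟩ h
    exact Subtype.ext (Subtype.ext (wordSet_injective σ.2 τ.2 (congrArg Subtype.val h)))
  · rintro ⟨S, hS, hinv⟩
    obtain ⟨σ, hσ, rfl⟩ := exists_isSorted_wordSet_eq hn S hS
    exact ⟨⟨⟨σ, hσ⟩, (hfix _).mpr hinv⟩, rfl⟩

end WordSet

/-! ### The Gaussian binomial coefficient at roots of unity -/

section GaussianBinomial

theorem qInt_add (k l : ℕ) : qInt (k + l) = qInt k + X ^ k * qInt l := by
  rw [qInt, Finset.sum_range_add, qInt, qInt, Finset.mul_sum]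
  simp only [pow_add]

theorem qFactorial_succ (k : ℕ) : qFactorial (k + 1) = qFactorial k * qInt (k + 1) :=
  Finset.prod_range_succ _ _

theorem qFactorial_zero : qFactorial 0 = 1 := rfl

theorem qBinomial_zero_right (k : ℕ) : qBinomial k 0 = 1 := by
  have h := qBinomial_mul (Nat.zero_le k)
  rw [qFactorial_zero, one_mul, Nat.sub_zero] at h
  exact mul_right_cancel₀ (qFactorial_ne_zero k) (h.trans (one_mul _).symm)

theorem qBinomial_self (k : ℕ) : qBinomial k k = 1 := by
  have h := qBinomial_mul (le_refl k)
  rw [Nat.sub_self, qFactorial_zero, mul_one] at h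
  exact mul_right_cancel₀ (qFactorial_ne_zero k) (h.trans (one_mul _).symm)

theorem qBinomial_succ_succ {k r : ℕ} (h : r + 1 ≤ k) :
    qBinomial (k + 1) (r + 1) = qBinomial k r + X ^ (r + 1) * qBinomial k (r + 1) := by
  have h0 : qFactorial (r + 1) * qFactorial (k - r) ≠ 0 :=
    mul_ne_zero (qFactorial_ne_zero _) (qFactorial_ne_zero _)
  refine mul_right_cancel₀ h0 ?_
  have e1 := qBinomial_mul (show r + 1 ≤ k + 1 by omega)
  have e2 := qBinomial_mul (show r ≤ k by omega)
  have e3 := qBinomial_mul h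
  rw [show k + 1 - (r + 1) = k - r by omega] at e1
  have e4 : qFactorial (k - r) = qFactorial (k - (r + 1)) * qInt (k - r) := by
    rw [show k - r = k - (r + 1) + 1 by omega]
    exact qFactorial_succ _
  have e5 : qInt (k + 1) = qInt (r + 1) + X ^ (r + 1) * qInt (k - r) := by
    rw [← qInt_add]
    congr 1
    omega
  rw [e1, qFactorial_succ k, e5, mul_add, add_mul]
  congr 1
  · rw [← e2, qFactorial_succ r]
    ring
  · rw [← e3, e4]
    ring

/-- The value at `x` of the `q`-binomial coefficient, extended by zero to all indices. -/
noncomputable def qBinomialEval (x : ℂ) (k r : ℕ) : ℂ :=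
  if r ≤ k then (qBinomial k r).eval x else 0

theorem qBinomialEval_zero_right (x : ℂ) (k : ℕ) : qBinomialEval x k 0 = 1 := by
  simp [qBinomialEval, qBinomial_zero_right]

theorem qBinomialEval_self (x : ℂ) (k : ℕ) : qBinomialEval x k k = 1 := by
  simp [qBinomialEval, qBinomial_self]

theorem qBinomialEval_of_lt (x : ℂ) {k r : ℕ} (h : k < r) : qBinomialEval x k r = 0 :=
  if_neg (by omega)

theorem qBinomialEval_succ_succ (x : ℂ) (k r : ℕ) :
    qBinomialEval x (k + 1) (r + 1) =
      qBinomialEval x k r + x ^ (r + 1) * qBinomialEval x k (r + 1) := by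
  rcases lt_trichotomy r k with h | rfl | h
  · rw [qBinomialEval, qBinomialEval, qBinomialEval, if_pos (by omega), if_pos (by omega),
      if_pos (by omega), qBinomial_succ_succ (by omega)]
    simp
  · rw [qBinomialEval_self, qBinomialEval_self, qBinomialEval_of_lt x (Nat.lt_succ_self _)]
    simp
  · rw [qBinomialEval_of_lt x h, qBinomialEval_of_lt x (by omega), qBinomialEval_of_lt x (by omega)]
    simp

theorem qInt_eval_mul (x : ℂ) (k : ℕ) : (qInt k).eval x * (x - 1) = x ^ k - 1 := by
  rw [qInt, eval_finsetSum]
  simp only [eval_pow, eval_X]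
  exact geom_sum_mul x k

theorem qBinomialEval_eq_zero {x : ℂ} {s : ℕ} (hx : IsPrimitiveRoot x s) {r : ℕ} (hr : 0 < r)
    (hrs : r < s) : qBinomialEval x s r = 0 := by
  have hx1 : x ≠ 1 := hx.ne_one (by omega)
  have hne : ∀ k, k < s → (qFactorial k).eval x ≠ 0 := by
    intro k
    induction k with
    | zero => simp [qFactorial_zero]
    | succ k ih =>
      intro hk
      rw [qFactorial_succ, eval_mul]
      refine mul_ne_zero (ih (by omega)) fun h => ?_
      have h1 := qInt_eval_mul x (k + 1)
      rw [h, zero_mul] at h1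
      exact hx.pow_ne_one_of_pos_of_lt (by omega) hk (sub_eq_zero.mp h1.symm)
  have hzero : (qFactorial s).eval x = 0 := by
    obtain ⟨s, rfl⟩ : ∃ k, s = k + 1 := ⟨s - 1, by omega⟩
    rw [qFactorial_succ, eval_mul]
    refine mul_eq_zero_of_right _ ?_
    have h1 := qInt_eval_mul x (s + 1)
    rw [hx.pow_eq_one, sub_self] at h1
    exact (mul_eq_zero.mp h1).resolve_right (sub_ne_zero.mpr hx1)
  rw [qBinomialEval, if_pos hrs.le]
  have h := congrArg (eval x) (qBinomial_mul hrs.le)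
  rw [eval_mul, eval_mul, hzero] at h
  exact (mul_eq_zero.mp h).resolve_right (mul_ne_zero (hne r hrs) (hne _ (by omega)))

/-- The `q`-analogue of Lucas's theorem, at a primitive `s`-th root of unity. -/
theorem qBinomialEval_lucas {x : ℂ} {s : ℕ} (hs : 0 < s) (hx : IsPrimitiveRoot x s) (u i : ℕ)
    (hi : i < s) : ∀ v j, j < s →
    qBinomialEval x (s * u + i) (s * v + j) = u.choose v * qBinomialEval x i j := by
  have hone : ∀ v j, x ^ (s * v + j) = x ^ j := fun v j => by
    rw [pow_add, pow_mul, hx.pow_eq_one, one_pow, one_mul]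
  -- one step of the Pascal recursion, inside a block of length `s`
  have hstep : ∀ u i, i + 1 < s → (∀ v j, j < s →
      qBinomialEval x (s * u + i) (s * v + j) = u.choose v * qBinomialEval x i j) →
      ∀ v j, j < s →
        qBinomialEval x (s * u + (i + 1)) (s * v + j) = u.choose v * qBinomialEval x (i + 1) j := by
    intro u i hi ih v j hj
    rcases j with _ | j
    · rw [qBinomialEval_zero_right, add_zero]
      rcases v with _ | v
      · simp [qBinomialEval_zero_right]
      · have h1 := ih v (s - 1) (by omega)
        have h2 := ih (v + 1) 0 hs
        obtain ⟨w, hw⟩ : ∃ w, s * (v + 1) = w + 1 := ⟨s * (v + 1) - 1, by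
          have : 0 < s * (v + 1) := Nat.mul_pos hs (Nat.succ_pos v)
          omega⟩
        rw [show s * v + (s - 1) = w by rw [mul_add] at hw; omega,
          qBinomialEval_of_lt x (show i < s - 1 by omega)] at h1
        rw [add_zero, qBinomialEval_zero_right, hw] at h2
        have h3 := hone (v + 1) 0
        rw [add_zero, hw] at h3
        rw [hw, ← add_assoc, qBinomialEval_succ_succ, h1, h2, h3]
        simp
    · rw [← add_assoc, ← add_assoc, qBinomialEval_succ_succ, ih v j (by omega), add_assoc,
        hone, ih v (j + 1) hj, qBinomialEval_succ_succ]
      ring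
  have hblock : ∀ u, (∀ v j, j < s →
      qBinomialEval x (s * u) (s * v + j) = u.choose v * qBinomialEval x 0 j) →
      ∀ i, i < s → ∀ v j, j < s →
        qBinomialEval x (s * u + i) (s * v + j) = u.choose v * qBinomialEval x i j := by
    intro u hu i
    induction i with
    | zero => exact fun _ => hu
    | succ i ih => exact fun hi => hstep u i hi (ih (by omega))
  refine hblock u ?_ i hi
  clear hi i
  induction u with
  | zero =>
    intro v j hj
    rcases v with _ | v
    · simp
    · rw [mul_zero, qBinomialEval_of_lt x (by
        have : 0 < s * (v + 1) := Nat.mul_pos hs (Nat.succ_pos v)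
        omega)]
      simp
  | succ u ih =>
    have hlast := hblock u ih (s - 1) (by omega)
    have hu : s * (u + 1) = s * u + (s - 1) + 1 := by rw [mul_add]; omega
    intro v j hj
    rcases j with _ | j
    · rw [qBinomialEval_zero_right, add_zero]
      rcases v with _ | v
      · simp [qBinomialEval_zero_right]
      · have h1 := hlast v (s - 1) (by omega)
        have h2 := hlast (v + 1) 0 hs
        have h3 := hone (v + 1) 0
        have hv : s * (v + 1) = s * v + (s - 1) + 1 := by rw [mul_add]; omega
        rw [qBinomialEval_self] at h1
        rw [add_zero, qBinomialEval_zero_right, hv] at h2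
        rw [add_zero, hv] at h3
        rw [hu, hv, qBinomialEval_succ_succ, h1, h2, h3, Nat.choose_succ_succ]
        push_cast
        ring
    · have h1 := hlast v j (by omega)
      have h2 := hlast v (j + 1) hj
      have h3 := qBinomialEval_succ_succ x (s - 1) j
      rw [show s - 1 + 1 = s by omega, qBinomialEval_eq_zero hx (Nat.succ_pos j) hj] at h3
      rw [hu, ← add_assoc, qBinomialEval_succ_succ, h1, add_assoc, h2, hone,
        qBinomialEval_of_lt x (Nat.succ_pos j)]
      linear_combination -(u.choose v : ℂ) * h3

end GaussianBinomial

/-! ### Fixed points, order and cyclic sieving -/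

section NoFixedPoints

variable {n : ℕ} {X Y : Type*}

/-- The operator `f` carries the order in which the labels of each summand occur along the path
to the order of their images under `g`. -/
def CarriesOrder (g : Equiv.Perm (X ⊕ Y)) (f : Equiv.Perm (Fin n ≃ X ⊕ Y)) : Prop :=
  (∀ x, (g x).isLeft = x.isLeft) ∧ ∀ σ x y, x.isLeft = y.isLeft →
    ((f σ).symm (g x) < (f σ).symm (g y) ↔ σ.symm x < σ.symm y)

theorem CarriesOrder.one : CarriesOrder (1 : Equiv.Perm (X ⊕ Y)) (1 : Equiv.Perm (Fin n ≃ X ⊕ Y)) :=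
  ⟨fun _ => rfl, fun _ _ _ _ => Iff.rfl⟩

theorem CarriesOrder.mul {g g' : Equiv.Perm (X ⊕ Y)} {f f' : Equiv.Perm (Fin n ≃ X ⊕ Y)}
    (h : CarriesOrder g f) (h' : CarriesOrder g' f') : CarriesOrder (g * g') (f * f') := by
  refine ⟨fun x => (h.1 _).trans (h'.1 x), fun σ x y hxy => ?_⟩
  rw [Equiv.Perm.mul_apply, Equiv.Perm.mul_apply, Equiv.Perm.mul_apply,
    h.2 _ _ _ (by rw [h'.1, h'.1, hxy]), h'.2 _ _ _ hxy]

theorem CarriesOrder.pow {g : Equiv.Perm (X ⊕ Y)} {f : Equiv.Perm (Fin n ≃ X ⊕ Y)}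
    (h : CarriesOrder g f) (k : ℕ) : CarriesOrder (g ^ k) (f ^ k) := by
  induction k with
  | zero => exact CarriesOrder.one
  | succ k ih =>
    rw [pow_succ, pow_succ]
    exact ih.mul h

theorem CarriesOrder.relabel {g : Equiv.Perm (X ⊕ Y)} (hg : ∀ x, (g x).isLeft = x.isLeft) :
    CarriesOrder g (relabel (Fin n) g) :=
  ⟨hg, fun σ x y _ => by simp⟩

theorem carriesOrder_prod_bounce [DecidableEq X] [DecidableEq Y] {ι : Type*} (u : ι → X)
    (v : ι → Y) (l : List ι) : CarriesOrder 1 (l.map fun i =>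
      bounce (SimpleGraph.pathGraph n) (Sum.inl (u i)) (Sum.inr (v i) : X ⊕ Y)).prod := by
  induction l with
  | nil => exact CarriesOrder.one
  | cons i l ih =>
    rw [List.map_cons, List.prod_cons, ← one_mul (1 : Equiv.Perm (X ⊕ Y))]
    refine CarriesOrder.mul ⟨fun _ => rfl, fun σ x y hxy => ?_⟩ ih
    refine bounce_symm_lt_iff σ ?_ ?_
    · rintro ⟨rfl, rfl⟩
      simp at hxy
    · rintro ⟨rfl, rfl⟩
      simp at hxy

theorem exists_apply_eq_of_lt_iff_lt {k : ℕ} {α : Type*} [LinearOrder α] {f : Fin (k + 1) → α}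
    (hf : Function.Injective f) (r : Equiv.Perm (Fin (k + 1)))
    (hr : ∀ x y, f (r x) < f (r y) ↔ f x < f y) : ∃ x, r x = x := by
  obtain ⟨x, hx⟩ := Finite.exists_min f
  refine ⟨x, hf (le_antisymm ?_ (hx _))⟩
  obtain ⟨y, hy⟩ := r.surjective x
  by_contra h
  have h1 : f (r y) < f (r x) := by rw [hy]; exact not_le.mp h
  exact absurd ((hr _ _).mp h1) (not_lt.mpr (hx y))

theorem dvd_of_finRotate_pow_apply_eq {k j : ℕ} {x : Fin (k + 1)}
    (h : (finRotate (k + 1) ^ j) x = x) : k + 1 ∣ j := by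
  rw [finRotate_pow_apply, add_eq_left] at h
  have := congrArg Fin.val h
  simpa [Nat.dvd_iff_mod_eq_zero] using this

/-- If a power of standard promotion has a fixed point, then it shifts each of the two families of
lines trivially: the shift preserves the linear order in which the lines occur along the path, and
so it fixes the first of them. -/
theorem dvd_of_mem_fixedPoints {p q k : ℕ} {σ : Fin n ≃ Fin (p + 1) ⊕ Fin (q + 1)}
    (h : ((passColumn (SimpleGraph.pathGraph n) p q *
      passRow (SimpleGraph.pathGraph n) p q) ^ k) σ = σ) : p + 1 ∣ k ∧ q + 1 ∣ k := by
  have hcol : CarriesOrder (Equiv.sumCongr (finRotate (p + 1)) 1)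
      (passColumn (SimpleGraph.pathGraph n) p q) := by
    rw [← one_mul (Equiv.sumCongr (finRotate (p + 1)) (1 : Equiv.Perm (Fin (q + 1))))]
    exact (carriesOrder_prod_bounce (fun _ => 0) id _).mul
      (CarriesOrder.relabel fun x => by cases x <;> rfl)
  have hrow : CarriesOrder (Equiv.sumCongr 1 (finRotate (q + 1)))
      (passRow (SimpleGraph.pathGraph n) p q) := by
    rw [← one_mul (Equiv.sumCongr (1 : Equiv.Perm (Fin (p + 1))) (finRotate (q + 1)))]
    exact (carriesOrder_prod_bounce id (fun _ => 0) _).mul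
      (CarriesOrder.relabel fun x => by cases x <;> rfl)
  have hk := ((hcol.mul hrow).pow k).2 σ
  have hg : (Equiv.sumCongr (finRotate (p + 1)) (1 : Equiv.Perm (Fin (q + 1))) *
      Equiv.sumCongr 1 (finRotate (q + 1))) ^ k =
      Equiv.sumCongr (finRotate (p + 1) ^ k) (finRotate (q + 1) ^ k) := by
    have h1 := map_pow (Equiv.Perm.sumCongrHom (Fin (p + 1)) (Fin (q + 1)))
      (finRotate (p + 1), finRotate (q + 1)) k
    have h2 := map_mul (Equiv.Perm.sumCongrHom (Fin (p + 1)) (Fin (q + 1)))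
      (finRotate (p + 1), 1) (1, finRotate (q + 1))
    rw [Prod.mk_mul_mk, mul_one, one_mul] at h2
    rw [h2] at h1
    exact h1.symm
  rw [h, hg] at hk
  constructor
  · obtain ⟨x, hx⟩ := exists_apply_eq_of_lt_iff_lt (f := fun a => σ.symm (Sum.inl a))
      (fun a a' haa => Sum.inl_injective (σ.symm.injective haa)) (finRotate (p + 1) ^ k)
      fun x y => hk (Sum.inl x) (Sum.inl y) rfl
    exact dvd_of_finRotate_pow_apply_eq hx
  · obtain ⟨x, hx⟩ := exists_apply_eq_of_lt_iff_lt (f := fun b => σ.symm (Sum.inr b))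
      (fun a a' haa => Sum.inr_injective (σ.symm.injective haa)) (finRotate (q + 1) ^ k)
      fun x y => hk (Sum.inr x) (Sum.inr y) rfl
    exact dvd_of_finRotate_pow_apply_eq hx

end NoFixedPoints

section Standard

variable {n p q : ℕ}

theorem card_fixedPoints_standard_of_not_dvd {k : ℕ} (h : ¬ (p + 1 ∣ k ∧ q + 1 ∣ k)) :
    Nat.card (Function.fixedPoints ((passColumn (SimpleGraph.pathGraph n) p q *
      passRow (SimpleGraph.pathGraph n) p q) ^ k)) = 0 := by
  have : IsEmpty (Function.fixedPoints ((passColumn (SimpleGraph.pathGraph n) p q *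
      passRow (SimpleGraph.pathGraph n) p q) ^ k)) :=
    ⟨fun σ => h (dvd_of_mem_fixedPoints σ.2)⟩
  exact Nat.card_of_isEmpty

theorem card_fixedPoints_standard (hn : n = p + 1 + (q + 1)) {k d' : ℕ} (hp : p + 1 ∣ k)
    (hq : q + 1 ∣ k) (hd' : p + 1 = n / n.gcd (k / (p + 1) + k / (q + 1)) * d') :
    Nat.card (Function.fixedPoints ((passColumn (SimpleGraph.pathGraph n) p q *
      passRow (SimpleGraph.pathGraph n) p q) ^ k)) =
      (p + 1).factorial * (q + 1).factorial *
        (n.gcd (k / (p + 1) + k / (q + 1))).choose d' := by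
  have : Fact (1 < n) := ⟨by omega⟩
  have : NeZero n := ⟨by omega⟩
  rw [passColumn_mul_passRow_pow _ hp hq, card_fixedPoints_gridProd_bounce,
    card_fixedPoints_sortedBounce_pow hn, ← ZMod.card_translation_invariant, ← hd']

theorem orderOf_standard (hn : n = p + 1 + (q + 1)) :
    orderOf (passColumn (SimpleGraph.pathGraph n) p q * passRow (SimpleGraph.pathGraph n) p q) =
      (p + 1) * (q + 1) := by
  have hfact : Fact (1 < n) := ⟨by omega⟩
  have hne : NeZero n := ⟨by omega⟩
  refine Nat.dvd_antisymm (orderOf_dvd_of_pow_eq_one ?_) ?_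
  · have ht : (p + 1) * (q + 1) / (p + 1) + (p + 1) * (q + 1) / (q + 1) = n := by
      rw [Nat.mul_div_cancel_left _ (Nat.succ_pos p), Nat.mul_div_cancel _ (Nat.succ_pos q)]
      omega
    have hcard := card_fixedPoints_standard hn (k := (p + 1) * (q + 1)) (d' := p + 1)
      (Nat.dvd_mul_right _ _) (Nat.dvd_mul_left _ _) (by
        rw [ht, Nat.gcd_self, Nat.div_self (by omega), one_mul])
    rw [ht, Nat.gcd_self] at hcard
    have hall : Nat.card (Fin n ≃ Fin (p + 1) ⊕ Fin (q + 1)) = n.factorial := by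
      rw [Nat.card_eq_fintype_card, Fintype.card_equiv
        ((finCongr hn).trans finSumFinEquiv.symm), Fintype.card_fin]
    have hfac := Nat.choose_mul_factorial_mul_factorial (show p + 1 ≤ n by omega)
    rw [show n - (p + 1) = q + 1 by omega] at hfac
    have huniv : Function.fixedPoints ((passColumn (SimpleGraph.pathGraph n) p q *
        passRow (SimpleGraph.pathGraph n) p q) ^ ((p + 1) * (q + 1))) = Set.univ := by
      refine Set.eq_of_subset_of_ncard_le (Set.subset_univ _) ?_
      rw [Set.ncard_univ, hall, ← hfac, ← Nat.card_coe_set_eq, hcard]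
      exact le_of_eq (by ring)
    ext1 σ
    have : σ ∈ Function.fixedPoints ((passColumn (SimpleGraph.pathGraph n) p q *
        passRow (SimpleGraph.pathGraph n) p q) ^ ((p + 1) * (q + 1))) := huniv ▸ Set.mem_univ σ
    exact this
  · set k := orderOf (passColumn (SimpleGraph.pathGraph n) p q *
      passRow (SimpleGraph.pathGraph n) p q) with hk
    have hpow := pow_orderOf_eq_one (passColumn (SimpleGraph.pathGraph n) p q *
      passRow (SimpleGraph.pathGraph n) p q)
    rw [← hk] at hpow
    obtain ⟨hp, hq⟩ := dvd_of_mem_fixedPoints (σ := (finCongr hn).trans finSumFinEquiv.symm)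
      (n := n) (p := p) (q := q) (k := k) (by rw [hpow]; rfl)
    rw [passColumn_mul_passRow_pow _ hp hq] at hpow
    set t := k / (p + 1) + k / (q + 1) with ht
    -- the set of the first `p + 1` residues is only invariant under the trivial translation
    let S : Finset (ZMod n) := Finset.univ.filter fun x => x.val < p + 1
    have hS : S.card = p + 1 := by
      rw [← Finset.card_image_of_injective _ (ZMod.val_injective n),
        ← Finset.card_range (p + 1)]
      congr 1
      ext i
      simp only [S, Finset.mem_image, Finset.mem_filter, Finset.mem_univ, true_and,
        Finset.mem_range]
      constructor
      · rintro ⟨x, hx, rfl⟩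
        exact hx
      · intro hi
        have := ZMod.val_natCast_of_lt (show i < n by omega)
        exact ⟨i, by rwa [this], this⟩
    obtain ⟨σ, hσ, hσS⟩ := exists_isSorted_wordSet_eq (m := q + 1) hn S hS
    have hone : ((gridProd fun (a : Fin (p + 1)) (b : Fin (q + 1)) => sortedBounce n a b) ^ t)
        ⟨σ, hσ⟩ = ⟨σ, hσ⟩ :=
      Subtype.ext ((coe_gridProd_sortedBounce_pow id id t _).trans
        (congrArg (fun f => f σ) hpow))
    have hinv : ∀ x : ZMod n, x + (t : ZMod n) ∈ S ↔ x ∈ S := by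
      intro x
      have := add_mem_wordSet_pow t ⟨σ, hσ⟩ x
      rwa [hone, hσS] at this
    have h0 : (t : ZMod n) ∈ S := by
      have := (hinv 0).mpr (by simp [S])
      rwa [zero_add] at this
    have h1 : (t : ZMod n) - 1 ∉ S := by
      intro h
      have h2 := (hinv (-1)).mp (by rwa [add_comm, ← sub_eq_add_neg])
      have h3 := ZMod.val_add_one_eq (-1 : ZMod n)
      have h4 : (-1 : ZMod n).val < p + 1 := by simpa [S] using h2
      rw [neg_add_cancel, ZMod.val_zero, if_neg (by omega)] at h3
      omega
    have h2 := ZMod.val_add_one_eq ((t : ZMod n) - 1)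
    rw [sub_add_cancel] at h2
    have h3 : (t : ZMod n).val < p + 1 := by simpa [S] using h0
    have h4 : ¬ ((t : ZMod n) - 1).val < p + 1 := by simpa [S] using h1
    have h5 : (t : ZMod n).val = 0 := by
      split_ifs at h2 <;> omega
    have h6 : n ∣ t := (ZMod.natCast_eq_zero_iff _ _).mp ((ZMod.val_eq_zero _).mp h5)
    have h7 : (p + 1) * (q + 1) * t = n * k := by
      obtain ⟨u, hu⟩ := hp
      obtain ⟨v, hv⟩ := hq
      have e1 : k / (p + 1) = u := by rw [hu]; exact Nat.mul_div_cancel_left _ (Nat.succ_pos p)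
      have e2 : k / (q + 1) = v := by rw [hv]; exact Nat.mul_div_cancel_left _ (Nat.succ_pos q)
      rw [ht, e1, e2, hn]
      calc (p + 1) * (q + 1) * (u + v) = (q + 1) * ((p + 1) * u) + (p + 1) * ((q + 1) * v) := by ring
        _ = (q + 1) * k + (p + 1) * k := by rw [← hu, ← hv]
        _ = _ := by ring
    obtain ⟨w, hw⟩ := h6
    refine ⟨w, ?_⟩
    rw [hw] at h7
    refine Nat.eq_of_mul_eq_mul_left (NeZero.pos n) ?_
    rw [← h7]
    ring

end Standard

section Evaluation

theorem eval_sievingPolynomial (x : ℂ) {n d : ℕ} (hd : 0 < d) (hdn : d < n) :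
    (sievingPolynomial n d).eval x =
      (n * (d - 1).factorial * (n - d - 1).factorial : ℕ) * (qInt (n - d)).eval (x ^ d) *
        qBinomialEval x (n - 1) (d - 1) := by
  rw [sievingPolynomial, eval_mul, eval_mul, eval_natCast, eval_comp, eval_pow, eval_X,
    qBinomialEval, if_pos (by omega)]

/-- In base `s = orderOf x`, the last digit of `d - 1` is `s - 1`, and the last digit of `n - 1` is
smaller than that unless `s` divides `n`. -/
theorem qBinomialEval_pred_pred {x : ℂ} {n d : ℕ} (hd : 0 < d) (hdn : d < n)
    (hs : orderOf x ∣ d) : qBinomialEval x (n - 1) (d - 1) =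
      if orderOf x ∣ n then ((n / orderOf x - 1).choose (d / orderOf x - 1) : ℂ) else 0 := by
  set s := orderOf x with hsdef
  have hx : IsPrimitiveRoot x s := IsPrimitiveRoot.orderOf x
  have hs0 : 0 < s := Nat.pos_of_dvd_of_pos hs hd
  have hsucc : ∀ k, 0 < k → s ∣ k → k - 1 = s * (k / s - 1) + (s - 1) := by
    rintro k hk ⟨c, rfl⟩
    have hc : 0 < c := Nat.pos_of_mul_pos_left hk
    obtain ⟨c, rfl⟩ : ∃ c', c = c' + 1 := ⟨c - 1, by omega⟩
    rw [Nat.mul_div_cancel_left _ hs0, Nat.add_sub_cancel, mul_add]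
    omega
  rw [hsucc d hd hs]
  split_ifs with h
  · rw [hsucc n (by omega) h, qBinomialEval_lucas hs0 hx _ _ (by omega) _ _ (by omega),
      qBinomialEval_self, mul_one]
  · have hmod := Nat.mod_lt (n - 1) hs0
    have hne : (n - 1) % s ≠ s - 1 := by
      intro he
      refine h ⟨(n - 1) / s + 1, ?_⟩
      have := Nat.div_add_mod (n - 1) s
      rw [he] at this
      rw [mul_add]
      omega
    have key := qBinomialEval_lucas hs0 hx ((n - 1) / s) ((n - 1) % s) hmod (d / s - 1) (s - 1)
      (by omega)
    rw [Nat.div_add_mod] at key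
    rw [key, qBinomialEval_of_lt x (by omega), mul_zero]

/-- The cyclic sieving phenomenon for standard promotion, for exponents in `ℕ`. If `q + 1 ∤ k`, then
the factor `[n - d]_{q^d}` vanishes; if `q + 1 ∣ k` and `p + 1 ∤ k`, then the `q`-binomial
coefficient vanishes. -/
theorem card_fixedPoints_standard_eq_eval {n p q : ℕ} (hn : n = p + 1 + (q + 1)) (k : ℕ) :
    (Nat.card (Function.fixedPoints ((passColumn (SimpleGraph.pathGraph n) p q *
      passRow (SimpleGraph.pathGraph n) p q) ^ k)) : ℂ) =
      (sievingPolynomial n (p + 1)).eval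
        (Complex.exp (2 * Real.pi * Complex.I * k / ((p + 1) * (q + 1) : ℕ))) := by
  obtain ⟨d, hd⟩ : ∃ d, d = p + 1 := ⟨_, rfl⟩
  obtain ⟨m, hm⟩ : ∃ m, m = q + 1 := ⟨_, rfl⟩
  have hd0 : 0 < d := by omega
  have hm0 : 0 < m := by omega
  have hn0 : 0 < n := by omega
  have hζ : IsPrimitiveRoot (Complex.exp (2 * Real.pi * Complex.I / (d * m : ℕ))) (d * m) :=
    Complex.isPrimitiveRoot_exp _ (Nat.mul_pos hd0 hm0).ne'
  set ζ := Complex.exp (2 * Real.pi * Complex.I / (d * m : ℕ)) with hζdef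
  have hxζ : Complex.exp (2 * Real.pi * Complex.I * k / ((p + 1) * (q + 1) : ℕ)) = ζ ^ k := by
    rw [hζdef, ← Complex.exp_nat_mul, hd, hm]
    congr 1
    ring
  rw [hxζ]
  set x := ζ ^ k with hx
  have hpow : ∀ j, x ^ j = 1 ↔ d * m ∣ k * j := fun j => by
    rw [hx, ← pow_mul, hζ.pow_eq_one_iff_dvd]
  have hxd : x ^ d = 1 ↔ m ∣ k := by
    rw [hpow, mul_comm k d, Nat.mul_dvd_mul_iff_left hd0]
  have hxm : x ^ m = 1 ↔ d ∣ k := by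
    rw [hpow, Nat.mul_dvd_mul_iff_right hm0]
  have hev := eval_sievingPolynomial x hd0 (show d < n by omega)
  have hpd : (sievingPolynomial n (p + 1)).eval x = (sievingPolynomial n d).eval x := by rw [hd]
  rw [show n - d = m by omega] at hev
  rw [hpd, hev]
  by_cases hmk : m ∣ k
  · have hxd1 := hxd.mpr hmk
    have hsd : orderOf x ∣ d := orderOf_dvd_of_pow_eq_one hxd1
    rw [qBinomialEval_pred_pred hd0 (by omega) hsd]
    by_cases hdk : d ∣ k
    · have hsn : orderOf x ∣ n := by
        rw [hn, ← hd, ← hm]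
        exact dvd_add hsd (orderOf_dvd_of_pow_eq_one (hxm.mpr hdk))
      obtain ⟨t, ht⟩ : ∃ t, t = k / (p + 1) + k / (q + 1) := ⟨_, rfl⟩
      -- the power of promotion is a rotation by `t`, and `x` is the corresponding `n`-th root of
      -- unity
      have hxt : x = Complex.exp (2 * Real.pi * Complex.I / n) ^ t := by
        obtain ⟨u, hu⟩ := hdk
        obtain ⟨v, hv⟩ := hmk
        have e1 : k / (p + 1) = u := by rw [← hd, hu]; exact Nat.mul_div_cancel_left _ hd0
        have e2 : k / (q + 1) = v := by rw [← hm, hv]; exact Nat.mul_div_cancel_left _ hm0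
        have hu' : (k : ℂ) = d * u := by exact_mod_cast hu
        have hv' : (k : ℂ) = m * v := by exact_mod_cast hv
        have hdc : (d : ℂ) ≠ 0 := by exact_mod_cast hd0.ne'
        have hmc : (m : ℂ) ≠ 0 := by exact_mod_cast hm0.ne'
        have hnc : (n : ℂ) ≠ 0 := by exact_mod_cast hn0.ne'
        have hnc' : (n : ℂ) = d + m := by
          rw [hn, ← hd, ← hm]
          push_cast
          rfl
        rw [hx, hζdef, ← Complex.exp_nat_mul, ← Complex.exp_nat_mul, ht, e1, e2]
        congr 1
        have key : (k : ℂ) * n = (u + v) * (d * m) := by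
          rw [hnc']
          linear_combination (d : ℂ) * hv' + (m : ℂ) * hu'
        push_cast
        field_simp
        linear_combination key
      have hs : orderOf x = n / n.gcd t := by
        have hξ := Complex.isPrimitiveRoot_exp n hn0.ne'
        rw [hxt, (hξ.isOfFinOrder hn0.ne').orderOf_pow, ← hξ.eq_orderOf]
      obtain ⟨d', hd'⟩ := hsd
      have hgn : n.gcd t ∣ n := Nat.gcd_dvd_left n t
      have hg0 : 0 < n.gcd t := Nat.gcd_pos_of_pos_left _ hn0
      have hs0 : 0 < orderOf x := Nat.pos_of_dvd_of_pos hsn hn0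
      have hcard := card_fixedPoints_standard hn (k := k) (d' := d') (hd ▸ hdk) (hm ▸ hmk)
        (by rw [← ht, ← hs, ← hd, hd'])
      rw [hcard, ← ht, if_pos hsn, hxd1, ← hd, ← hm]
      have hns : n / orderOf x = n.gcd t := by
        rw [hs]
        exact Nat.div_div_self hgn hn0.ne'
      have hds : d / orderOf x = d' := by
        rw [hd']
        exact Nat.mul_div_cancel_left _ hs0
      rw [hns, hds]
      have hd'0 : 0 < d' := by
        refine Nat.pos_of_ne_zero fun h => ?_
        rw [h, mul_zero] at hd'
        omega
      have hqm : (qInt m).eval 1 = m := by simp [qInt, eval_finsetSum]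
      rw [hqm]
      have hchoose : n * (n.gcd t - 1).choose (d' - 1) = d * (n.gcd t).choose d' := by
        have h1 := Nat.add_one_mul_choose_eq (n.gcd t - 1) (d' - 1)
        rw [Nat.sub_add_cancel hg0, Nat.sub_add_cancel hd'0] at h1
        have h2 : n = orderOf x * n.gcd t := by
          rw [hs, Nat.div_mul_cancel hgn]
        calc n * (n.gcd t - 1).choose (d' - 1)
            = orderOf x * (n.gcd t * (n.gcd t - 1).choose (d' - 1)) := by
              rw [← mul_assoc, ← h2]
          _ = orderOf x * d' * (n.gcd t).choose d' := by rw [h1]; ring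
          _ = _ := by rw [← hd']
      have hfd : d.factorial = d * (d - 1).factorial := (Nat.mul_factorial_pred hd0.ne').symm
      have hfm : m.factorial = m * (m - 1).factorial := (Nat.mul_factorial_pred hm0.ne').symm
      have hchoose' : (n : ℂ) * (n.gcd t - 1).choose (d' - 1) = d * (n.gcd t).choose d' := by
        exact_mod_cast hchoose
      rw [hfd, hfm]
      push_cast
      linear_combination -((d - 1).factorial * (m - 1).factorial * m : ℂ) * hchoose'
    · have hsn : ¬ orderOf x ∣ n := by
        intro h
        rw [hn, ← hd, ← hm] at h
        exact hdk (hxm.mp (orderOf_dvd_iff_pow_eq_one.mp ((Nat.dvd_add_right hsd).mp h)))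
      rw [if_neg hsn, mul_zero, card_fixedPoints_standard_of_not_dvd fun h => hdk (hd ▸ h.1),
        Nat.cast_zero]
  · have hne : x ^ d ≠ 1 := fun h => hmk (hxd.mp h)
    have h1 := qInt_eval_mul (x ^ d) m
    have h2 : (x ^ d) ^ m = 1 := by
      rw [← pow_mul, hpow]
      exact Nat.dvd_mul_left _ _
    rw [h2, sub_self] at h1
    rw [(mul_eq_zero.mp h1).resolve_right (sub_ne_zero.mpr hne), mul_zero, zero_mul,
      card_fixedPoints_standard_of_not_dvd fun h => hmk (hm ▸ h.2), Nat.cast_zero]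

end Evaluation

theorem card_fixedPoints_permCongr {α β : Type*} (e : α ≃ β) (f : Equiv.Perm α) :
    Nat.card (Function.fixedPoints (e.permCongr f)) = Nat.card (Function.fixedPoints f) := by
  refine (Nat.card_congr (e.subtypeEquiv fun x => ?_)).symm
  simp [Function.fixedPoints, Function.IsFixedPt]

theorem theorem1p2 (n : ℕ) (hn : 2 ≤ n) (π : Fin n ≃ ZMod n) (d : ℕ)
    (hd : d = cyclicDescents π) :
    orderOf (permutoricPromotion (SimpleGraph.pathGraph n) π) = d * (n - d) ∧
      CyclicSieving (permutoricPromotion (SimpleGraph.pathGraph n) π)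
        (sievingPolynomial n d) := by
  obtain ⟨⟨hd0, hdn⟩, hconj⟩ := isConj_permutoricPromotion hn π hd
  clear hd
  obtain ⟨p, rfl⟩ : ∃ p, d = p + 1 := ⟨d - 1, by omega⟩
  obtain ⟨q, rfl⟩ : ∃ q, n = p + 1 + (q + 1) := ⟨n - (p + 1) - 1, by omega⟩
  set f := permutoricPromotion (SimpleGraph.pathGraph (p + 1 + (q + 1))) π with hf
  set T := passColumn (SimpleGraph.pathGraph (p + 1 + (q + 1))) p q *
    passRow (SimpleGraph.pathGraph (p + 1 + (q + 1))) p q with hT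
  let E := (Equiv.refl (Fin (p + 1 + (q + 1)))).equivCongr (linePos p q)
  have hE : ∀ k : ℕ, E.permCongr (T ^ k) = E.permCongr T ^ k := fun k =>
    map_pow E.permCongrHom T k
  rw [Nat.add_sub_cancel_left, prod_toggle_standard, hopChain_mul_hopChain, ← hT] at hconj
  have hcard : ∀ k : ℕ, Nat.card (Function.fixedPoints (f ^ k)) =
      Nat.card (Function.fixedPoints (T ^ k)) := fun k => by
    rw [card_fixedPoints_of_isConj (hconj.pow k), ← hE, card_fixedPoints_permCongr]
  have horder : orderOf f = (p + 1) * (q + 1) := by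
    obtain ⟨c, hc⟩ := hconj
    rw [hc.orderOf_eq, ← orderOf_standard (n := p + 1 + (q + 1)) rfl]
    exact E.permCongrHom.orderOf_eq T
  refine ⟨by rw [horder, Nat.add_sub_cancel_left], fun k => ?_⟩
  -- reduce the exponent modulo the order
  have hpos : (0 : ℤ) < ((p + 1) * (q + 1) : ℕ) := by positivity
  obtain ⟨r, hr⟩ := Int.eq_ofNat_of_zero_le (Int.emod_nonneg k hpos.ne')
  have hk : f ^ k = f ^ r := by
    rw [← zpow_mod_orderOf, horder, hr]
    exact zpow_natCast f r
  rw [hk, hcard, card_fixedPoints_standard_eq_eval rfl, horder]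
  congr 1
  rw [Complex.exp_eq_exp_iff_exists_int]
  refine ⟨-(k / ((p + 1) * (q + 1) : ℕ)), ?_⟩
  have h1 := Int.emod_add_mul_ediv k ((p + 1) * (q + 1) : ℕ)
  rw [hr] at h1
  have h2 : (k : ℂ) = r + ((p + 1) * (q + 1) : ℕ) * (k / ((p + 1) * (q + 1) : ℕ) : ℤ) := by
    exact_mod_cast h1.symm
  have h3 : (((p + 1) * (q + 1) : ℕ) : ℂ) ≠ 0 := by exact_mod_cast hpos.ne'
  rw [h2]
  generalize (((p + 1) * (q + 1) : ℕ) : ℂ) = w at h3 ⊢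
  push_cast
  field_simp
  ring
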